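/- Let $n\ge 2$ and consider the standard $n$-local star network: $n$ independent sources; the $i$-th source distributes a two-qubit state $\rho_i$, the first qubit going to the central party and the second to the $i$-th extreme party. For a two-qubit state $\rho_i$ let $E_{i1}\ge E_{i2}\ge E_{i3}$ be the singular values of its correlation tensor $T_i=(\mathrm{Tr}[\rho_i\,\sigma_j\otimes\sigma_k])_{j,k=1}^3$. For even $k$ with $0\le k\le n$ let $G_k$ be the sum of $\prod_{i=1}^n E_{i h_i}^{1/n}$ over all $h\in\{1,2\}^n$ in which the value $2$ occurs exactly $k$ times, and put $$\Sigma=\sum_{0\le k\le n,\ k\text{ even}}\Big(\prod_{i=1}^n E_{i1}^{\,n-k}E_{i2}^{\,k}\Big)^{1/n^3}G_k,\qquad N=\sqrt{\prod_{i=1}^nE_{i1}^{2/n^2}+\prod_{i=1}^nE_{i2}^{2/n^2}},$$ $$V=\frac{\Sigma}{2^{n-2}N},\qquad t=\arcsin\sqrt{\frac{\prod_{i=1}^nE_{i2}^{2/n^2}}{\prod_{i=1}^nE_{i1}^{2/n^2}+\prod_{i=1}^nE_{i2}^{2/n^2}}} .$$ Consider the condition $$(\ast)\qquad 2^{n^2}\,N\,\Big(\prod_{i=1}^n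 E_{i1}^{1/n^2}+\prod_{i=1}^n E_{i2}^{1/n^2}\Big)^{n-1}<(4\Sigma)^n .$$ A correlation $P(b,a_1,\dots,a_n\mid x_1,\dots,x_n)$ with $b\in\{0,1\}^n$ the output of the central party and $a_i,x_i\in\{0,1\}$ is called $n$-local if $P=\int P(b\mid\lambda_1,\dots,\lambda_n)\prod_i p(a_i\mid x_i,\lambda_i)\,d\mu_1(\lambda_1)\cdots d\mu_n(\lambda_n)$ for some probability measures $\mu_i$ and response functions. The star $n$-local inequality is $$\frac1{2^{n-2}}\sum_{S\subseteq\{1,\dots,n\},\ |S|\text{ even}}|J_S|^{1/n}\le 1,\qquad J_S=\frac1{2^n}\sum_{x}(-1)^{\sum_{j\in S}x_j}\sum_{b,a}(-1)^{\tilde b_S+a_1+\dots+a_n}P(b,a\mid x),$$ where the bit $\tilde b_S$ is computed from $b$ so that $(-1)^{\tilde b_S}$ is the eigenvalue, on the GHZ basis vector $\frac1{\sqrt2}\big(|0,b_2,\dots,b_n\rangle+(-1)^{b_1}|1,1-b_2,\dots,1-b_n\rangle\big)$, of the tensor product with $\sigma_2$ at the positions in $S$ and $\sigma_1$ at the others.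 Theorem. For every $n\ge2$ there are two-qubit states $\rho_1,\dots,\rho_n$ satisfying $(\ast)$. Let $\rho_1,\dots,\rho_n$ be any two-qubit states satisfying $(\ast)$. Then: (a) there are local unitaries $U_i,W_i$ such that $\rho_i'=(U_i\otimes W_i)\rho_i(U_i\otimes W_i)^\dagger$ has correlation tensor $\mathrm{diag}(E_{i1},E_{i2},\pm E_{i3})$ for every $i$; (b) $\dfrac{(\cos t+\sin t)^{n-1}}{V^n}<1$; (c) for any $\rho_i'$ as in (a), any choice of one extreme party $s$, and any $\eta_s$ with $\dfrac{(\cos t+\sin t)^{n-1}}{V^n}<\eta_s\le1$, the pair of dichotomic measurements of $\eta_s(\cos t\,\sigma_1\pm\sin t\,\sigma_2)$ is incompatible, and there are $\eta_i\in[0,1]$ for the other extreme parties $i\ne s$ such that each pair of dichotomic measurements of $\eta_i(\cos t\,\sigma_1\pm\sin t\,\sigma_2)$, $i\neq s$, is compatible, while the correlation obtained from the sources $\rho_1',\dots,\rho_n'$, when the central party measures in the $n$-qubit GHZ basis and every extreme party $i$ performs its pair with parameter $\eta_i$, violates the star $n$-local inequality and is not $n$-local. Here the dichotomic measurement of an observable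 $A$ has effects $(\mathbb 1\pm A)/2$, and a pair of measurements is compatible if both are classical post-processings of one parent POVM, incompatible otherwise. -/

import Mathlib

open scoped Matrix Kronecker ComplexOrder

universe u

noncomputable section

namespace StarNetwork

/-! ### Two-qubit sources -/

/-- The Pauli matrices `σ₁, σ₂, σ₃` (indexed by `0, 1, 2`). -/
def pauli : Fin 3 → Matrix (Fin 2) (Fin 2) ℂ :=
  ![!![0, 1; 1, 0], !![0, -Complex.I; Complex.I, 0], !![1, 0; 0, -1]]

/-- Matrices on a pair of qubits. For a source, the first qubit is sent to the central party and
the second qubit to the extreme party attached to that source. -/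
abbrev TwoQubit : Type := Matrix (Fin 2 × Fin 2) (Fin 2 × Fin 2) ℂ

/-- Density matrices. -/
def IsState (ρ : TwoQubit) : Prop := ρ.PosSemidef ∧ ρ.trace = 1

/-- The correlation tensor `T j k = Tr[ρ (σ_j ⊗ σ_k)]`, a real `3 × 3` matrix. The trace is a real
number when `ρ` is Hermitian. -/
def corrTensor (ρ : TwoQubit) : Matrix (Fin 3) (Fin 3) ℝ :=
  Matrix.of fun j k => ((ρ * (pauli j ⊗ₖ pauli k)).trace).re

/-- The singular values of the correlation tensor, in decreasing order. -/
def singVal (ρ : TwoQubit) (k : Fin 3) : ℝ :=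
  (Matrix.toEuclideanLin (corrTensor ρ)).singularValues k

/-- Local change of basis `(U ⊗ W) ρ (U ⊗ W)†`. -/
def localRotate (U W : Matrix.unitaryGroup (Fin 2) ℂ) (ρ : TwoQubit) : TwoQubit :=
  ((U : Matrix (Fin 2) (Fin 2) ℂ) ⊗ₖ (W : Matrix (Fin 2) (Fin 2) ℂ)) * ρ *
    ((U : Matrix (Fin 2) (Fin 2) ℂ) ⊗ₖ (W : Matrix (Fin 2) (Fin 2) ℂ))ᴴ

/-- The correlation tensor is diagonal and lists the singular values in decreasing order.
The third entry is only determined up to its sign, since local unitaries act on the correlation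
tensor by rotations and so preserve its determinant. -/
def IsCanonical (ρ : TwoQubit) : Prop :=
  ∃ ε : ℝ, (ε = 1 ∨ ε = -1) ∧
    corrTensor ρ = Matrix.diagonal ![singVal ρ 0, singVal ρ 1, ε * singVal ρ 2]

/-! ### Measurements -/

/-- A finite-outcome POVM on a qubit. -/
def IsPOVM {m : ℕ} (G : Fin m → Matrix (Fin 2) (Fin 2) ℂ) : Prop :=
  (∀ l, (G l).PosSemidef) ∧ ∑ l, G l = 1

/-- Two dichotomic qubit measurements `M x a` (input `x`, output `a`) are compatible if they are
classical post-processings `M x a = ∑ l, p a x l • G l` of a single parent POVM `G`. -/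
def Compatible (M : Fin 2 → Fin 2 → Matrix (Fin 2) (Fin 2) ℂ) : Prop :=
  ∃ (m : ℕ) (G : Fin m → Matrix (Fin 2) (Fin 2) ℂ) (p : Fin 2 → Fin 2 → Fin m → ℝ),
    IsPOVM G ∧ (∀ a x l, 0 ≤ p a x l) ∧ (∀ x l, ∑ a, p a x l = 1) ∧
      ∀ x a, M x a = ∑ l, (p a x l : ℂ) • G l

/-- The noisy equatorial observable `η (cos t σ₁ + (-1)^j sin t σ₂)`. -/
def noisyObs (η t : ℝ) (j : Fin 2) : Matrix (Fin 2) (Fin 2) ℂ :=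
  (η : ℂ) • (((Real.cos t : ℝ) : ℂ) • pauli 0 +
    ((-1 : ℂ) ^ (j : ℕ) * ((Real.sin t : ℝ) : ℂ)) • pauli 1)

/-- The pair of dichotomic measurements of these two observables: on input `j`, the effect of
outcome `a` is `(1 + (-1)^a A_j) / 2`. -/
def noisyPair (η t : ℝ) (j a : Fin 2) : Matrix (Fin 2) (Fin 2) ℂ :=
  (1 / 2 : ℂ) • (1 + (-1 : ℂ) ^ (a : ℕ) • noisyObs η t j)

/-- The `n`-qubit GHZ basis: for `b = (b₁, …, bₙ)` it is the vector
`(|0 b₂ … bₙ⟩ + (-1)^b₁ |1 (1-b₂) … (1-bₙ)⟩) / √2`. -/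
def ghzVec {n : ℕ} [NeZero n] (b c : Fin n → Fin 2) : ℂ :=
  if c = Function.update b 0 0 then ((1 / √2 : ℝ) : ℂ)
  else if c = (fun i => 1 - Function.update b 0 0 i) then
    (-1 : ℂ) ^ (b 0 : ℕ) * ((1 / √2 : ℝ) : ℂ)
  else 0

/-- The projector on a GHZ basis vector. -/
def ghzProj {n : ℕ} [NeZero n] (b : Fin n → Fin 2) :
    Matrix (Fin n → Fin 2) (Fin n → Fin 2) ℂ :=
  Matrix.of fun c c' => ghzVec b c * star (ghzVec b c')

/-! ### Quantum correlations in the star network -/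

/-- Tensor product of single-qubit operators. -/
def tensorOp {n : ℕ} (A : Fin n → Matrix (Fin 2) (Fin 2) ℂ) :
    Matrix (Fin n → Fin 2) (Fin n → Fin 2) ℂ :=
  Matrix.of fun e e' => ∏ i, A i (e i) (e' i)

/-- The product of the `n` source states, with the `n` qubits of the central party grouped in the
first factor and the qubits of the extreme parties in the second one. -/
def jointState {n : ℕ} (ρ : Fin n → TwoQubit) :
    Matrix ((Fin n → Fin 2) × (Fin n → Fin 2)) ((Fin n → Fin 2) × (Fin n → Fin 2)) ℂ :=
  Matrix.of fun s s' => ∏ i, ρ i (s.1 i, s.2 i) (s'.1 i, s'.2 i)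

/-- Conditional distributions `P b a x` of a star network: `b` is the output string of the central
party, `a i` and `x i` are the output and the input of the `i`-th extreme party. -/
abbrev Correlation (n : ℕ) : Type :=
  (Fin n → Fin 2) → (Fin n → Fin 2) → (Fin n → Fin 2) → ℝ

/-- The correlations produced when the central party measures in the GHZ basis and the `i`-th
extreme party performs the measurements `M i x a`. -/
def quantumCorr {n : ℕ} [NeZero n] (ρ : Fin n → TwoQubit)
    (M : Fin n → Fin 2 → Fin 2 → Matrix (Fin 2) (Fin 2) ℂ) : Correlation n :=
  fun b a x => (((ghzProj b ⊗ₖ tensorOp fun i => M i (x i) (a i)) * jointState ρ).trace).re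

/-- `n`-locality in the star network: independent hidden variables `l i`, one for each source, the
central party's response depends on all of them, and that of the `i`-th extreme party on `l i`. -/
def IsNLocal {n : ℕ} (P : Correlation n) : Prop :=
  ∃ (Λ : Fin n → Type u) (_ : ∀ i, MeasurableSpace (Λ i))
    (μ : ∀ i, MeasureTheory.Measure (Λ i))
    (_ : ∀ i, MeasureTheory.IsProbabilityMeasure (μ i))
    (pc : (Fin n → Fin 2) → (∀ i, Λ i) → ℝ)
    (q : ∀ i, Fin 2 → Fin 2 → Λ i → ℝ),
    (∀ b, Measurable (pc b)) ∧ (∀ b l, 0 ≤ pc b l) ∧ (∀ l, ∑ b, pc b l = 1) ∧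
    (∀ i a x, Measurable (q i a x)) ∧ (∀ i a x l, 0 ≤ q i a x l) ∧
    (∀ i x l, ∑ a, q i a x l = 1) ∧
    ∀ b a x, P b a x = ∫ l, pc b l * ∏ i, q i (a i) (x i) (l i) ∂(MeasureTheory.Measure.pi μ)

/-! ### The star `n`-local inequality -/

/-- The bit (modulo 2) that the central party computes from its output string `b` for the even set
`S`: `(-1)^(centralBit S b)` is the eigenvalue, on the GHZ vector of `b`, of the operator with
`σ₂` at the positions in `S` and `σ₁` elsewhere. -/
def centralBit {n : ℕ} [NeZero n] (S : Finset (Fin n)) (b : Fin n → Fin 2) : ℕ :=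
  S.card / 2 + (b 0 : ℕ) + ∑ j ∈ S.erase 0, (b j : ℕ)

/-- The correlator `⟨D⁽ˢ⁾ D_{x₁} … D_{xₙ}⟩`. -/
def correlator {n : ℕ} [NeZero n] (P : Correlation n) (S : Finset (Fin n))
    (x : Fin n → Fin 2) : ℝ :=
  ∑ b, ∑ a : Fin n → Fin 2, (-1 : ℝ) ^ (centralBit S b + ∑ j, (a j : ℕ)) * P b a x

/-- The quantity `J_S = 2⁻ⁿ ∑ₓ (-1)^(∑_{j ∈ S} x_j) ⟨D⁽ˢ⁾ D_{x₁} … D_{xₙ}⟩`. -/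
def starJ {n : ℕ} [NeZero n] (P : Correlation n) (S : Finset (Fin n)) : ℝ :=
  (1 / 2 ^ n) * ∑ x : Fin n → Fin 2, (-1 : ℝ) ^ (∑ j ∈ S, (x j : ℕ)) * correlator P S x

/-- Left-hand side of the star `n`-local inequality `2^(-(n-2)) ∑_S |J_S|^(1/n) ≤ 1` (for `2 ≤ n`),
where `S` runs over the `2^(n-1)` sets of extreme parties of even size. -/
def starLHS {n : ℕ} [NeZero n] (P : Correlation n) : ℝ :=
  (1 / 2 ^ (n - 2)) *
    ∑ S : Finset (Fin n) with Even S.card, |starJ P S| ^ (1 / (n : ℝ))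

/-! ### The singular-value condition -/

/-- `∏ᵢ E_{ik}^s`. In the definitions below `E i 0 ≥ E i 1 ≥ E i 2` are the singular values for
the `i`-th source. -/
def prodPow {n : ℕ} (E : Fin n → Fin 3 → ℝ) (k : Fin 3) (s : ℝ) : ℝ := ∏ i, E i k ^ s

/-- `√(∏ᵢ E_{i1}^(2/n²) + ∏ᵢ E_{i2}^(2/n²))`. -/
def normFactor {n : ℕ} (E : Fin n → Fin 3 → ℝ) : ℝ :=
  √(prodPow E 0 (2 / (n : ℝ) ^ 2) + prodPow E 1 (2 / (n : ℝ) ^ 2))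

/-- The angle `t`. -/
def angle {n : ℕ} (E : Fin n → Fin 3 → ℝ) : ℝ :=
  Real.arcsin √(prodPow E 1 (2 / (n : ℝ) ^ 2) /
    (prodPow E 0 (2 / (n : ℝ) ^ 2) + prodPow E 1 (2 / (n : ℝ) ^ 2)))

/-- `G_k`: the sum of `∏ᵢ E_{i,hᵢ}^(1/n)` over the `h` in `{1,2}ⁿ` in which `2` occurs exactly
`k` times (the value `1` is coded by `0 : Fin 2` and `2` by `1 : Fin 2`). -/
def gSum {n : ℕ} (E : Fin n → Fin 3 → ℝ) (k : ℕ) : ℝ :=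
  ∑ h : Fin n → Fin 2 with (Finset.univ.filter fun i => h i = 1).card = k,
    ∏ i, E i (h i).castSucc ^ (1 / (n : ℝ))

/-- `∑_{k even, 0 ≤ k ≤ n} (∏ᵢ E_{i1}^(n-k) E_{i2}^k)^(1/n³) G_k`. -/
def evenSum {n : ℕ} (E : Fin n → Fin 3 → ℝ) : ℝ :=
  ∑ k ∈ Finset.range (n + 1) with Even k,
    (∏ i, E i 0 ^ (n - k) * E i 1 ^ k) ^ (1 / (n : ℝ) ^ 3) * gSum E k

/-- The value `V` (for `2 ≤ n`) of the left-hand side of the star inequality in the absence of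
measurement noise. -/
def starV {n : ℕ} (E : Fin n → Fin 3 → ℝ) : ℝ := evenSum E / (2 ^ (n - 2) * normFactor E)

/-- The condition on the singular values of the sources. -/
def SourceCondition {n : ℕ} (E : Fin n → Fin 3 → ℝ) : Prop :=
  2 ^ (n ^ 2) * normFactor E *
      (prodPow E 0 (1 / (n : ℝ) ^ 2) + prodPow E 1 (1 / (n : ℝ) ^ 2)) ^ (n - 1) <
    (4 * evenSum E) ^ n

/-- The lower bound `(cos t + sin t)^(n-1) / Vⁿ` for the noise parameter of the incompatible
pair. -/
def etaBound {n : ℕ} (E : Fin n → Fin 3 → ℝ) : ℝ :=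
  (Real.cos (angle E) + Real.sin (angle E)) ^ (n - 1) / starV E ^ n

end StarNetwork

end

/-! Write `r = cos t + sin t`. The signed average over the two inputs of party `i` leaves `η_i cos t
σ₁` or `η_i sin t σ₂`, and the signed sum of GHZ projectors is the matching product of `σ₁`'s and
`σ₂`'s. So for canonical sources `J_S = ∏_{i∉S} η_i cos t E_{i1} · ∏_{i∈S} η_i sin t E_{i2}`
(`starJ_quantumCorr`), and the left side of the star inequality is `(∏ η_i)^(1/n) V`
(`starLHS_quantumCorr`).

A noisy pair with `η r > 1` is incompatible, and one with `η r = 1` is compatible. Giving every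
party but `s` the value `1/r` turns violation into `η_s Vⁿ > r^(n-1)`, which is the assumed lower
bound on `η_s`. Incompatibility at `s` follows because `V ≤ r`: entries of a correlation tensor are
at most `1`, and AM-GM does the rest (`starV_le_cos_add_sin`). Condition `(∗)` is `r^(n-1)/Vⁿ < 1`
with denominators cleared, as `cos t` and `sin t` are `∏ E_{i1}^(1/n²)` and `∏ E_{i2}^(1/n²)`
divided by `N`.

In an `n`-local model `|J_S|` is at most a product of means of `|D₀ ± D₁|/2`, whose two values at
each party sum to at most `1`; AM-GM over the even sets gives the inequality (`starLHS_le_one`).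
Canonical form is the singular value decomposition by rotations, each lifted to a unitary
(`exists_unitary_actsAs`). Bell states satisfy `(∗)`, which for them reads `√2 < 2`. -/

namespace StarNetwork

/-! ### Sums over sets of even size -/

section Combinatorics

theorem sum_finset_prod_ite {ι R : Type*} [Fintype ι] [DecidableEq ι] [CommSemiring R]
    (x y : ι → R) :
    ∑ S : Finset ι, ∏ i, (if i ∈ S then y i else x i) = ∏ i, (y i + x i) := by
  rw [Finset.prod_add, Finset.powerset_univ]
  refine Finset.sum_congr rfl fun S _ => ?_
  rw [Finset.prod_ite]
  congr 1
  · exact Finset.prod_congr (by ext; simp) fun _ _ => rfl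
  · exact Finset.prod_congr (by ext; simp) fun _ _ => rfl

/-- Once there are two indices, half of the even sets contain `i`. Averaging the sums over all sets
weighted by `1` and by `(-1)^|S|` selects the even ones. -/
theorem sum_even_ite_mem {ι : Type*} [Fintype ι] [DecidableEq ι] (hι : 2 ≤ Fintype.card ι)
    (i : ι) (a b : ℝ) :
    ∑ S : Finset ι with Even S.card, (if i ∈ S then b else a) =
      2 ^ (Fintype.card ι - 2) * (a + b) := by
  have hprod : ∀ (S : Finset ι) (c : ℝ),
      ∏ j, (if j ∈ S then (if j = i then c * b else c) else (if j = i then a else 1)) =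
        c ^ S.card * (if i ∈ S then b else a) := by
    intro S c
    have : ∀ j, (if j ∈ S then (if j = i then c * b else c) else (if j = i then a else 1)) =
        (if j ∈ S then c else 1) * (if j = i then (if i ∈ S then b else a) else 1) := by
      intro j
      split_ifs <;> simp_all
    simp_rw [this]
    rw [Finset.prod_mul_distrib, Finset.prod_ite_eq' Finset.univ i]
    simp
  have hpos := sum_finset_prod_ite (fun j => if j = i then a else 1)
    (fun j => if j = i then (1 : ℝ) * b else 1)
  have hneg := sum_finset_prod_ite (fun j => if j = i then a else 1)
    (fun j => if j = i then (-1 : ℝ) * b else -1)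
  simp_rw [hprod] at hpos hneg
  -- Any second index `k ≠ i` contributes the factor `-1 + 1`.
  have h0 : ∏ j, ((if j = i then (-1 : ℝ) * b else -1) + if j = i then a else 1) = 0 := by
    obtain ⟨k, hk⟩ := Fintype.exists_ne_of_one_lt_card (by omega) i
    exact Finset.prod_eq_zero (Finset.mem_univ k) (by simp [hk])
  have h1 : ∏ j, ((if j = i then (1 : ℝ) * b else 1) + if j = i then a else 1) =
      (b + a) * 2 ^ (Fintype.card ι - 1) := by
    rw [← Finset.mul_prod_erase _ _ (Finset.mem_univ i)]
    congr 1
    · simp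
    · rw [Finset.prod_congr rfl (g := fun _ => (2 : ℝ))]
      · simp [Finset.card_erase_of_mem]
      · intro j hj
        simp only [Finset.mem_erase] at hj
        norm_num [hj.1]
  rw [h0] at hneg
  rw [h1] at hpos
  have hsum : ∑ S : Finset ι with Even S.card, (if i ∈ S then b else a) =
      (1 / 2) * (∑ S : Finset ι, 1 ^ S.card * (if i ∈ S then b else a) +
        ∑ S : Finset ι, (-1) ^ S.card * (if i ∈ S then b else a)) := by
    rw [Finset.sum_filter, ← Finset.sum_add_distrib, Finset.mul_sum]
    refine Finset.sum_congr rfl fun S _ => ?_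
    rcases Nat.even_or_odd S.card with h | h
    · rw [if_pos h, h.neg_one_pow, one_pow]; ring
    · rw [if_neg (Nat.not_even_iff_odd.2 h), h.neg_one_pow, one_pow]; ring
  rw [hsum, hpos, hneg]
  obtain ⟨m, hm⟩ := Nat.exists_eq_add_of_le hι
  rw [hm, show 2 + m - 1 = m + 1 by omega, show 2 + m - 2 = m by omega]
  ring

/-- Sum over the sets of even size of the geometric means, bounded through the arithmetic means. -/
theorem sum_even_prod_rpow_le {n : ℕ} (hn : 2 ≤ n) (α β : Fin n → ℝ)
    (hα : ∀ i, 0 ≤ α i) (hβ : ∀ i, 0 ≤ β i) :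
    ∑ S : Finset (Fin n) with Even S.card,
        (∏ i, (if i ∈ S then β i else α i)) ^ (1 / (n : ℝ)) ≤
      2 ^ (n - 2) * ((∑ i, (α i + β i)) / n) := by
  have hn0 : (0 : ℝ) < n := by exact_mod_cast (by omega : 0 < n)
  calc _ ≤ ∑ S : Finset (Fin n) with Even S.card,
        (∑ i, (if i ∈ S then β i else α i)) / (n : ℝ) := by
        refine Finset.sum_le_sum fun S _ => ?_
        have := Real.geom_mean_le_arith_mean Finset.univ (fun _ : Fin n => (1 : ℝ))
          (fun i => if i ∈ S then β i else α i) (fun _ _ => zero_le_one) (by simpa using hn0)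
          (fun i _ => by split_ifs; exacts [hβ i, hα i])
        simpa using this
    _ = _ := by
        rw [← Finset.sum_div, Finset.sum_comm]
        have := fun i => sum_even_ite_mem (by simpa using hn) i (α i) (β i)
        simp_rw [Fintype.card_fin] at this
        simp_rw [this]
        rw [← Finset.mul_sum, mul_div_assoc]

/-- The star functional of a product is a product. -/
theorem star_functional_prod {n : ℕ} [NeZero n] {R : Type*} [Field R] [CharZero R]
    (S : Finset (Fin n)) (w : (Fin n → Fin 2) → R) (q : Fin n → Fin 2 → Fin 2 → R) :
    (1 / 2 ^ n) * ∑ x : Fin n → Fin 2, (-1 : R) ^ (∑ j ∈ S, (x j : ℕ)) *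
        ∑ b, ∑ a : Fin n → Fin 2, (-1 : R) ^ (centralBit S b + ∑ j, (a j : ℕ)) *
          (w b * ∏ i, q i (a i) (x i)) =
      (∑ b, (-1 : R) ^ centralBit S b * w b) *
        ∏ i, ((1 / 2) * ∑ y : Fin 2, (if i ∈ S then (-1 : R) ^ (y : ℕ) else 1) *
          ∑ c : Fin 2, (-1 : R) ^ (c : ℕ) * q i c y) := by
  have hS : ∀ x : Fin n → Fin 2, (-1 : R) ^ (∑ j ∈ S, (x j : ℕ)) =
      ∏ i, (if i ∈ S then (-1 : R) ^ (x i : ℕ) else 1) := by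
    intro x
    rw [← Finset.prod_pow_eq_pow_sum, Finset.prod_ite_mem, Finset.univ_inter]
  rw [Finset.prod_mul_distrib, Finset.prod_const, Finset.card_univ, Fintype.card_fin,
    Finset.prod_univ_sum, Fintype.piFinset_univ, one_div_pow, mul_left_comm]
  congr 1
  rw [Finset.mul_sum]
  refine Finset.sum_congr rfl fun x _ => ?_
  rw [hS, Finset.prod_mul_distrib, mul_left_comm]
  congr 1
  rw [Finset.prod_univ_sum, Fintype.piFinset_univ, Finset.sum_mul]
  refine Finset.sum_congr rfl fun b _ => ?_
  rw [Finset.mul_sum]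
  refine Finset.sum_congr rfl fun a _ => ?_
  rw [Finset.prod_mul_distrib, Finset.prod_pow_eq_pow_sum, pow_add]
  ring

end Combinatorics

/-! ### The star inequality for `n`-local correlations -/

section LocalBound

open MeasureTheory

/-- The left side is `max |u| |v|`. -/
theorem abs_half_add_abs_half_le (u v : ℝ) (hu : |u| ≤ 1) (hv : |v| ≤ 1) :
    |(1 / 2) * (u + v)| + |(1 / 2) * (u - v)| ≤ 1 := by
  rw [abs_le] at hu hv
  rcases abs_cases ((1 / 2) * (u + v)) with h | h <;>
    rcases abs_cases ((1 / 2) * (u - v)) with h' | h' <;> linarith [h.1, h'.1]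

/-- The star `n`-local inequality. -/
theorem starLHS_le_one {n : ℕ} [NeZero n] (hn : 2 ≤ n) {P : Correlation n}
    (hP : IsNLocal.{u} P) : starLHS P ≤ 1 := by
  obtain ⟨Λ, _, μ, _, w, q, hwm, hw0, hw1, hqm, hq0, hq1, hPq⟩ := hP
  have hw_le : ∀ b l, w b l ≤ 1 := fun b l => by
    rw [← hw1 l]
    exact Finset.single_le_sum (f := fun b => w b l) (fun b _ => hw0 b l) (Finset.mem_univ b)
  have hq_le : ∀ i a x l, q i a x l ≤ 1 := fun i a x l => by
    rw [← hq1 i x l]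
    exact Finset.single_le_sum (f := fun a => q i a x l) (fun a _ => hq0 i a x l)
      (Finset.mem_univ a)
  let D : ∀ i, Fin 2 → Λ i → ℝ := fun i y l => ∑ c : Fin 2, (-1 : ℝ) ^ (c : ℕ) * q i c y l
  have hDm : ∀ i y, Measurable (D i y) := fun i y =>
    Finset.measurable_sum _ fun c _ => (hqm i c y).const_mul _
  have hD : ∀ i y l, |D i y l| ≤ 1 := fun i y l => by
    have h := hq1 i y l
    have h0 := hq0 i 0 y l
    have h1 := hq0 i 1 y l
    simp only [Fin.sum_univ_two] at h
    simp only [D, Fin.sum_univ_two, Fin.val_zero, Fin.val_one]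
    rw [abs_le]
    constructor <;> linarith
  let f : ∀ i, Λ i → ℝ := fun i l => |(1 / 2) * (D i 0 l + D i 1 l)|
  let g : ∀ i, Λ i → ℝ := fun i l => |(1 / 2) * (D i 0 l - D i 1 l)|
  have hfm : ∀ i, Measurable (f i) := fun i =>
    (((hDm i 0).add (hDm i 1)).const_mul _).norm
  have hgm : ∀ i, Measurable (g i) := fun i =>
    (((hDm i 0).sub (hDm i 1)).const_mul _).norm
  have hf0 : ∀ i l, 0 ≤ f i l := fun i l => abs_nonneg _
  have hg0 : ∀ i l, 0 ≤ g i l := fun i l => abs_nonneg _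
  have hfg : ∀ i l, f i l + g i l ≤ 1 := fun i l =>
    abs_half_add_abs_half_le _ _ (hD i 0 l) (hD i 1 l)
  have hfi : ∀ i, Integrable (f i) (μ i) := fun i =>
    Integrable.of_bound (hfm i).aestronglyMeasurable 1 (Filter.Eventually.of_forall fun l => by
      rw [Real.norm_of_nonneg (hf0 i l)]; linarith [hfg i l, hg0 i l])
  have hgi : ∀ i, Integrable (g i) (μ i) := fun i =>
    Integrable.of_bound (hgm i).aestronglyMeasurable 1 (Filter.Eventually.of_forall fun l => by
      rw [Real.norm_of_nonneg (hg0 i l)]; linarith [hfg i l, hf0 i l])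
  have hint : ∀ b (a x : Fin n → Fin 2),
      Integrable (fun l => w b l * ∏ i, q i (a i) (x i) (l i)) (Measure.pi μ) := by
    intro b a x
    refine Integrable.of_bound (Measurable.aestronglyMeasurable ?_) 1
      (Filter.Eventually.of_forall fun l => ?_)
    · refine (hwm b).mul (Finset.measurable_prod _ fun i _ => ?_)
      exact (hqm i (a i) (x i)).comp (measurable_pi_apply i)
    · have hp0 : 0 ≤ ∏ i, q i (a i) (x i) (l i) := Finset.prod_nonneg fun i _ => hq0 _ _ _ _
      have hp1 : ∏ i, q i (a i) (x i) (l i) ≤ 1 :=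
        Finset.prod_le_one (fun i _ => hq0 _ _ _ _) fun i _ => hq_le _ _ _ _
      rw [Real.norm_of_nonneg (mul_nonneg (hw0 b l) hp0)]
      exact mul_le_one₀ (hw_le b l) hp0 hp1
  have hJ : ∀ S : Finset (Fin n), starJ P S = ∫ l,
      (∑ b, (-1 : ℝ) ^ centralBit S b * w b l) *
        ∏ i, ((1 / 2) * ∑ y : Fin 2, (if i ∈ S then (-1 : ℝ) ^ (y : ℕ) else 1) * D i y (l i))
        ∂(Measure.pi μ) := by
    intro S
    simp_rw [D]
    have := fun l : ∀ i, Λ i => star_functional_prod S (fun b => w b l)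
      (fun i c y => q i c y (l i))
    simp_rw [← this]
    rw [starJ, integral_const_mul]
    congr 1
    rw [integral_finsetSum]
    · refine Finset.sum_congr rfl fun x _ => ?_
      rw [integral_const_mul]
      congr 1
      rw [correlator, integral_finsetSum]
      · refine Finset.sum_congr rfl fun b _ => ?_
        rw [integral_finsetSum]
        · refine Finset.sum_congr rfl fun a _ => ?_
          rw [integral_const_mul, hPq]
        · exact fun a _ => (hint b a x).const_mul _
      · exact fun b _ => integrable_finsetSum _ fun a _ => (hint b a x).const_mul _
    · exact fun x _ => Integrable.const_mul (integrable_finsetSum _ fun b _ =>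
        integrable_finsetSum _ fun a _ => (hint b a x).const_mul _) _
  -- The central factor has modulus at most `1`; independence of the sources splits the remaining
  -- integral into a product.
  have hJle : ∀ S : Finset (Fin n), |starJ P S| ≤
      ∏ i, (if i ∈ S then ∫ l, g i l ∂(μ i) else ∫ l, f i l ∂(μ i)) := by
    intro S
    have hprod : ∏ i, (if i ∈ S then ∫ l, g i l ∂(μ i) else ∫ l, f i l ∂(μ i)) =
        ∫ l, ∏ i, (if i ∈ S then g i else f i) (l i) ∂(Measure.pi μ) := by
      rw [integral_fintype_prod_eq_prod]
      refine Finset.prod_congr rfl fun i _ => ?_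
      split_ifs <;> rfl
    rw [hJ, hprod, ← Real.norm_eq_abs]
    refine norm_integral_le_of_norm_le (Integrable.fintype_prod_dep fun i => ?_)
      (Filter.Eventually.of_forall fun l => ?_)
    · split_ifs
      exacts [hgi i, hfi i]
    · rw [Real.norm_eq_abs, abs_mul, Finset.abs_prod]
      have hb : |∑ b, (-1 : ℝ) ^ centralBit S b * w b l| ≤ 1 := by
        refine (Finset.abs_sum_le_sum_abs _ _).trans ?_
        refine (Finset.sum_le_sum fun b _ => ?_).trans_eq (hw1 l)
        rw [abs_mul, abs_pow, abs_neg, abs_one, one_pow, one_mul, abs_of_nonneg (hw0 b l)]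
      refine (mul_le_of_le_one_left (Finset.prod_nonneg fun _ _ => abs_nonneg _) hb).trans
        (le_of_eq (Finset.prod_congr rfl fun i _ => ?_))
      split_ifs <;> simp [f, g, Fin.sum_univ_two, sub_eq_add_neg]
  have hn0 : (0 : ℝ) < n := by exact_mod_cast (by omega : 0 < n)
  rw [starLHS, one_div_mul_eq_div, div_le_one (by positivity)]
  calc _ ≤ ∑ S : Finset (Fin n) with Even S.card,
        (∏ i, (if i ∈ S then ∫ l, g i l ∂(μ i) else ∫ l, f i l ∂(μ i))) ^ (1 / (n : ℝ)) :=
        Finset.sum_le_sum fun S _ =>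
          Real.rpow_le_rpow (abs_nonneg _) (hJle S) (by positivity)
    _ ≤ _ := sum_even_prod_rpow_le hn _ _ (fun i => integral_nonneg (hf0 i))
        (fun i => integral_nonneg (hg0 i))
    _ ≤ 2 ^ (n - 2) * 1 := by
        refine mul_le_mul_of_nonneg_left ?_ (by positivity)
        rw [div_le_one hn0]
        calc _ ≤ ∑ i : Fin n, (1 : ℝ) := Finset.sum_le_sum fun i _ => by
              rw [← integral_add (hfi i) (hgi i)]
              calc _ ≤ ∫ _, (1 : ℝ) ∂(μ i) :=
                    integral_mono ((hfi i).add (hgi i)) (integrable_const _) (hfg i)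
                _ = 1 := by simp
          _ = n := by simp
    _ = _ := mul_one _

end LocalBound

/-! ### Hermitian involutions -/

section Pauli

open Matrix

theorem pauli_isHermitian (k : Fin 3) : (pauli k).IsHermitian := by
  ext i j
  fin_cases k <;> fin_cases i <;> fin_cases j <;> simp [pauli]

theorem pauli_mul_self (k : Fin 3) : pauli k * pauli k = 1 := by
  ext i j
  fin_cases k <;> fin_cases i <;> fin_cases j <;> simp [pauli, Matrix.mul_apply]

variable {ι : Type*} [Fintype ι] [DecidableEq ι]

/-- Half of `1 + A` is a projection; the Gram form makes its positivity visible. -/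
theorem one_add_eq_smul_sq {A : Matrix ι ι ℂ} (hA : A.IsHermitian) (hA2 : A * A = 1) :
    1 + A = (1 / 2 : ℝ) • ((1 + A)ᴴ * (1 + A)) := by
  have : (1 + A)ᴴ * (1 + A) = (2 : ℝ) • (1 + A) := by
    rw [conjTranspose_add, hA.eq, conjTranspose_one, add_mul, mul_add, mul_add, hA2, two_smul]
    simp only [mul_one, one_mul]
    abel
  rw [this, smul_smul]
  norm_num

theorem posSemidef_one_add {A : Matrix ι ι ℂ} (hA : A.IsHermitian) (hA2 : A * A = 1) :
    (1 + A).PosSemidef := by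
  rw [one_add_eq_smul_sq hA hA2]
  exact (posSemidef_conjTranspose_mul_self _).smul (by norm_num)

theorem neg_re_trace_mul_le {A G : Matrix ι ι ℂ} (hA : A.IsHermitian) (hA2 : A * A = 1)
    (hG : G.PosSemidef) : -(A * G).trace.re ≤ G.trace.re := by
  have h : 0 ≤ ((1 + A) * G).trace := by
    rw [one_add_eq_smul_sq hA hA2, smul_mul_assoc, trace_smul, Matrix.mul_assoc, trace_mul_comm]
    exact smul_nonneg (by norm_num) (hG.mul_mul_conjTranspose_same _).trace_nonneg
  rw [add_mul, one_mul, trace_add] at h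
  have := (Complex.le_def.1 h).1
  simp only [Complex.zero_re, Complex.add_re] at this
  linarith

theorem abs_re_trace_mul_le {A G : Matrix ι ι ℂ} (hA : A.IsHermitian) (hA2 : A * A = 1)
    (hG : G.PosSemidef) : |(A * G).trace.re| ≤ G.trace.re := by
  have h1 := neg_re_trace_mul_le hA hA2 hG
  have h2 := neg_re_trace_mul_le (A := -A) hA.neg (by rw [neg_mul_neg, hA2]) hG
  rw [neg_mul, trace_neg, Complex.neg_re, neg_neg] at h2
  exact abs_le.2 ⟨by linarith, h2⟩

end Pauli

/-! ### Compatibility of the noisy equatorial pair -/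

section Compatibility

open Matrix

theorem re_trace_pauli_zero_mul_noisyPair (η t : ℝ) (x a : Fin 2) :
    (pauli 0 * noisyPair η t x a).trace.re = (-1) ^ (a : ℕ) * (η * Real.cos t) := by
  rw [Matrix.trace_fin_two]
  simp only [Matrix.mul_apply, Fin.sum_univ_two, noisyPair, noisyObs]
  fin_cases x <;> fin_cases a <;>
    simp [pauli, -Complex.ofReal_cos, -Complex.ofReal_sin] <;> ring

theorem re_trace_pauli_one_mul_noisyPair (η t : ℝ) (x a : Fin 2) :
    (pauli 1 * noisyPair η t x a).trace.re =
      (-1) ^ (a : ℕ) * ((-1) ^ (x : ℕ) * (η * Real.sin t)) := by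
  rw [Matrix.trace_fin_two]
  simp only [Matrix.mul_apply, Fin.sum_univ_two, noisyPair, noisyObs]
  fin_cases x <;> fin_cases a <;>
    simp [pauli, -Complex.ofReal_cos, -Complex.ofReal_sin] <;> ring

/-- Compatibility of the noisy equatorial pair bounds the noise parameter. -/
theorem mul_cos_add_sin_le_one_of_compatible {η t : ℝ} (h : Compatible (noisyPair η t)) :
    η * (Real.cos t + Real.sin t) ≤ 1 := by
  obtain ⟨m, G, p, ⟨hG, hG1⟩, hp0, hp1, hM⟩ := h
  have hsum : ∀ (k : Fin 3) (x a : Fin 2), (pauli k * noisyPair η t x a).trace.re =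
      ∑ l, p a x l * (pauli k * G l).trace.re := by
    intro k x a
    rw [hM, Matrix.mul_sum, trace_sum, Complex.re_sum]
    refine Finset.sum_congr rfl fun l _ => ?_
    rw [Matrix.mul_smul, trace_smul, smul_eq_mul, Complex.re_ofReal_mul]
  have hτ : ∑ l, (G l).trace.re = 2 := by
    rw [← Complex.re_sum, ← trace_sum, hG1]
    simp
  have hc0 := hsum 0 0 0
  have hc1 := hsum 0 1 0
  have hc2 := hsum 0 0 1
  have hc3 := hsum 0 1 1
  have hs0 := hsum 1 0 0
  have hs1 := hsum 1 1 0
  have hs2 := hsum 1 0 1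
  have hs3 := hsum 1 1 1
  simp only [re_trace_pauli_zero_mul_noisyPair, re_trace_pauli_one_mul_noisyPair, Fin.val_zero,
    Fin.val_one, pow_zero, pow_one] at hc0 hc1 hc2 hc3 hs0 hs1 hs2 hs3
  -- With `u`, `v` the mean answers `p 0 x l - p 1 x l` to the two inputs, the coefficients are `u +
  -- v` and `u - v`, and `|u + v| + |u - v| ≤ 2`. Summed over `l`, the left side is `4η(cos t + sin
  -- t)` and the right side `4`.
  have hle : ∑ l, ((p 0 0 l + p 0 1 l - p 1 0 l - p 1 1 l) * (pauli 0 * G l).trace.re +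
      (p 0 0 l - p 0 1 l - p 1 0 l + p 1 1 l) * (pauli 1 * G l).trace.re) ≤
      ∑ l, 2 * (G l).trace.re := by
    refine Finset.sum_le_sum fun l _ => ?_
    have hr := abs_le.1 (abs_re_trace_mul_le (pauli_isHermitian 0) (pauli_mul_self 0) (hG l))
    have hs := abs_le.1 (abs_re_trace_mul_le (pauli_isHermitian 1) (pauli_mul_self 1) (hG l))
    have h0 := hp1 0 l
    have h1 := hp1 1 l
    rw [Fin.sum_univ_two] at h0 h1
    have e0 : p 1 0 l = 1 - p 0 0 l := by linarith
    have e1 : p 1 1 l = 1 - p 0 1 l := by linarith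
    have a0 := hp0 0 0 l
    have a1 := hp0 1 0 l
    have b0 := hp0 0 1 l
    have b1 := hp0 1 1 l
    rw [e0] at a1
    rw [e1] at b1
    rw [e0, e1]
    -- The products are the weights of the four deterministic pairs of answers; each pair leaves a
    -- single Pauli trace, bounded by the trace of `G l`.
    nlinarith [mul_nonneg a0 b0, mul_nonneg a0 b1, mul_nonneg a1 b0, mul_nonneg a1 b1,
      mul_nonneg (mul_nonneg a0 b0) (sub_nonneg.2 hr.2),
      mul_nonneg (mul_nonneg a1 b1) (sub_nonneg.2 hr.1),
      mul_nonneg (mul_nonneg a0 b1) (sub_nonneg.2 hs.2),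
      mul_nonneg (mul_nonneg a1 b0) (sub_nonneg.2 hs.1)]
  rw [← Finset.mul_sum, hτ, Finset.sum_add_distrib] at hle
  simp only [sub_mul, add_mul, Finset.sum_add_distrib, Finset.sum_sub_distrib, ← hc0, ← hc1,
    ← hc2, ← hc3, ← hs0, ← hs1, ← hs2, ← hs3] at hle
  linarith

/-- A parent measurement is obtained by measuring `σ₁` or `σ₂` at random. -/
theorem compatible_noisyPair {η t : ℝ} (hc : 0 ≤ η * Real.cos t) (hs : 0 ≤ η * Real.sin t)
    (h : η * (Real.cos t + Real.sin t) = 1) : Compatible (noisyPair η t) := by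
  have hP : ∀ k, (1 + pauli k).PosSemidef := fun k =>
    posSemidef_one_add (pauli_isHermitian k) (pauli_mul_self k)
  have hN : ∀ k, (1 + -pauli k).PosSemidef := fun k =>
    posSemidef_one_add (pauli_isHermitian k).neg (by rw [neg_mul_neg, pauli_mul_self])
  have h' : ((η * Real.cos t : ℝ) : ℂ) + ((η * Real.sin t : ℝ) : ℂ) = 1 := by
    rw [← Complex.ofReal_add, ← mul_add, h, Complex.ofReal_one]
  -- `σ₁` is measured with probability `η cos t` and `σ₂` with probability `η sin t`. A `σ₁` result
  -- is the answer to both inputs; a `σ₂` result is flipped on input `1`, where `σ₂` enters with a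
  -- minus sign.
  refine ⟨4, ![(η * Real.cos t / 2 : ℝ) • (1 + pauli 0), (η * Real.cos t / 2 : ℝ) • (1 + -pauli 0),
    (η * Real.sin t / 2 : ℝ) • (1 + pauli 1), (η * Real.sin t / 2 : ℝ) • (1 + -pauli 1)],
    fun a x => ![if a = 0 then 1 else 0, if a = 1 then 1 else 0, if a = x then 1 else 0,
      if a = x then 0 else 1], ⟨?_, ?_⟩, ?_, ?_, ?_⟩
  · intro l
    fin_cases l
    · exact (hP 0).smul (by positivity)
    · exact (hN 0).smul (by positivity)
    · exact (hP 1).smul (by positivity)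
    · exact (hN 1).smul (by positivity)
  · simp only [Fin.sum_univ_four, Matrix.cons_val]
    trans (η * (Real.cos t + Real.sin t)) • (1 : Matrix (Fin 2) (Fin 2) ℂ)
    · module
    · rw [h, one_smul]
  · intro a x l
    fin_cases a <;> fin_cases x <;> fin_cases l <;> simp
  · intro x l
    fin_cases x <;> fin_cases l <;> simp
  · intro x a
    simp only [Fin.sum_univ_four, Matrix.cons_val, noisyPair, noisyObs]
    have : (1 / 2 : ℂ) • (1 : Matrix (Fin 2) (Fin 2) ℂ) =
        (1 / 2 : ℂ) • (((η * Real.cos t : ℝ) : ℂ) + ((η * Real.sin t : ℝ) : ℂ)) • 1 := by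
      rw [h', one_smul]
    rw [smul_add, this]
    fin_cases a <;> fin_cases x <;>
      simp [-Complex.ofReal_cos, -Complex.ofReal_sin, ← Complex.coe_smul] <;> module

end Compatibility

/-! ### The GHZ measurement -/

section GHZ

theorem Fin.eq_one_of_ne_zero_two {u : Fin 2} (h : u ≠ 0) : u = 1 := by
  omega

variable {n : ℕ} [NeZero n]

/-- The bit string `c`, complemented if its first bit is `1`. -/
def ghzRep (c : Fin n → Fin 2) : Fin n → Fin 2 :=
  fun i => if c 0 = 0 then c i else 1 - c i

theorem ghzRep_apply (c : Fin n → Fin 2) (i : Fin n) :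
    ghzRep c i = if c 0 = 0 then c i else 1 - c i := rfl

theorem ghzRep_zero (c : Fin n → Fin 2) : ghzRep c 0 = 0 := by
  rw [ghzRep_apply]
  split_ifs with h
  · exact h
  · simp [Fin.eq_one_of_ne_zero_two h]

/-- Normalising `c` by complementation merges the two branches of the GHZ vector; the sign appears
only on the branch with first bit `1`. -/
theorem ghzVec_eq (b c : Fin n → Fin 2) :
    ghzVec b c = if Function.update b 0 0 = ghzRep c then
      (-1 : ℂ) ^ ((b 0 : ℕ) * (c 0 : ℕ)) * ((1 / √2 : ℝ) : ℂ) else 0 := by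
  have hrep : ghzRep c = if c 0 = 0 then c else fun i => 1 - c i := by
    funext i
    rw [ghzRep_apply]
    split_ifs <;> rfl
  rw [ghzVec, hrep]
  by_cases h : c 0 = 0
  · have h2 : ¬ c = fun i => 1 - Function.update b 0 0 i := fun hc => by
      have := congrFun hc 0
      simp [h] at this
    simp only [h, h2, if_true, if_false, eq_comm (a := c)]
    simp
  · have h1 := Fin.eq_one_of_ne_zero_two h
    have h2 : ¬ c = Function.update b 0 0 := fun hc => h (by rw [hc]; simp)
    have h3 : (c = fun i => 1 - Function.update b 0 0 i) ↔
        Function.update b 0 0 = fun i => 1 - c i := by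
      constructor <;> intro hc <;> funext i <;> have := congrFun hc i <;> beta_reduce at this ⊢ <;>
        omega
    simp only [h, h2, h3, if_false]
    simp [h1]

theorem sum_ghz_single (F : (Fin n → Fin 2) → ℂ) (d : Fin n → Fin 2) (hd : d 0 = 0) :
    ∑ b, (if Function.update b 0 0 = d then F b else 0) = F d + F (Function.update d 0 1) := by
  rw [Fintype.sum_eq_add d (Function.update d 0 1)]
  · have h1 : Function.update d 0 0 = d := by rw [← hd, Function.update_eq_self]
    simp [h1]
  · intro h
    have := congrFun h 0
    simp [hd] at this
  · rintro b ⟨hb0, hb1⟩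
    refine if_neg fun h => ?_
    by_cases hb : b 0 = 0
    · exact hb0 (by rw [← h, ← hb, Function.update_eq_self])
    · refine hb1 ?_
      rw [← h, Function.update_idem, ← Fin.eq_one_of_ne_zero_two hb, Function.update_eq_self]

theorem centralBit_update (S : Finset (Fin n)) (d : Fin n → Fin 2) (u : Fin 2) :
    centralBit S (Function.update d 0 u) =
      S.card / 2 + (u : ℕ) + ∑ j ∈ S.erase 0, (d j : ℕ) := by
  unfold centralBit
  rw [Function.update_self]
  congr 1
  refine Finset.sum_congr rfl fun j hj => ?_
  rw [Function.update_of_ne (Finset.ne_of_mem_erase hj)]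

theorem pauli_equatorial_diag {ι : Type*} [DecidableEq ι] (S : Finset ι) (i : ι) (u : Fin 2) :
    pauli (if i ∈ S then 1 else 0) u u = 0 := by
  split_ifs <;> fin_cases u <;> simp [pauli]

/-- The signed sum of the GHZ projectors is the tensor product of `σ₂` on `S` and of `σ₁`
elsewhere. -/
theorem sum_centralBit_ghzProj (S : Finset (Fin n)) (hS : Even S.card) (c c' : Fin n → Fin 2) :
    ∑ b, (-1 : ℂ) ^ centralBit S b * ghzProj b c c' =
      ∏ i, pauli (if i ∈ S then 1 else 0) (c i) (c' i) := by
  have hterm : ∀ b : Fin n → Fin 2, (-1 : ℂ) ^ centralBit S b * ghzProj b c c' =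
      if Function.update b 0 0 = ghzRep c then (if ghzRep c = ghzRep c' then
        (-1 : ℂ) ^ centralBit S b * ((-1) ^ ((b 0 : ℕ) * (c 0 : ℕ)) *
          (-1) ^ ((b 0 : ℕ) * (c' 0 : ℕ)) * (1 / 2)) else 0) else 0 := by
    intro b
    have h2 : ((1 / √2 : ℝ) : ℂ) * ((1 / √2 : ℝ) : ℂ) = 1 / 2 := by
      rw [← Complex.ofReal_mul, div_mul_div_comm, Real.mul_self_sqrt (by norm_num)]
      norm_num
    rw [ghzProj, Matrix.of_apply, ghzVec_eq, ghzVec_eq]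
    by_cases h : Function.update b 0 0 = ghzRep c
    · rw [if_pos h, if_pos h, h]
      by_cases h' : ghzRep c = ghzRep c'
      · rw [if_pos h', if_pos h', ← h2]
        simp only [star_mul', star_pow, star_neg, star_one, RCLike.star_def, Complex.conj_ofReal]
        ring
      · rw [if_neg h', if_neg h']
        simp
    · rw [if_neg h, if_neg h]
      simp
  simp_rw [hterm]
  rw [sum_ghz_single _ _ (ghzRep_zero c)]
  have hd : Function.update (ghzRep c) 0 0 = ghzRep c := by
    conv_lhs => rw [← ghzRep_zero c]
    rw [Function.update_eq_self]
  have hb0 : centralBit S (ghzRep c) = S.card / 2 + 0 + ∑ j ∈ S.erase 0, (ghzRep c j : ℕ) := by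
    conv_lhs => rw [← hd]
    exact centralBit_update S _ 0
  rw [hb0, centralBit_update, ghzRep_zero, Function.update_self]
  -- Both sides vanish unless `c'` is the complement of `c`. If the first bits agree, the two
  -- strings `b` differing in their first bit cancel, and equatorial Pauli matrices have zero
  -- diagonal.
  by_cases h0 : c 0 = c' 0
  · rw [Finset.prod_eq_zero (Finset.mem_univ (0 : Fin n)) (by rw [h0, pauli_equatorial_diag])]
    split_ifs
    · rw [h0]
      rcases Fin.exists_fin_two.1 ⟨c' 0, rfl⟩ with h | h <;> simp [h, pow_add]
    · simp
  by_cases hcc : ∀ i, c' i = 1 - c i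
  · have hrep : ghzRep c = ghzRep c' := by
      funext i
      rw [ghzRep_apply, ghzRep_apply]
      have hi := hcc i
      have h00 := hcc 0
      split_ifs <;> omega
    rw [if_pos hrep, if_pos hrep]
    have hfac : ∀ i, pauli (if i ∈ S then 1 else 0) (c i) (c' i) =
        if i ∈ S then (-Complex.I * (-1) ^ (c 0 : ℕ)) * (-1) ^ (ghzRep c i : ℕ) else 1 := by
      intro i
      rw [hcc i, ghzRep_apply]
      have hA : ∀ u v : Fin 2, pauli 1 u (1 - u) =
          (-Complex.I * (-1) ^ (v : ℕ)) * (-1) ^ ((if v = 0 then u else 1 - u : Fin 2) : ℕ) := by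
        intro u v
        fin_cases u <;> fin_cases v <;> simp [pauli]
      have hB : ∀ u : Fin 2, pauli 0 u (1 - u) = 1 := by
        intro u
        fin_cases u <;> simp [pauli]
      split_ifs with h1 h2
      · simpa [h2] using hA (c i) 0
      · simpa [Fin.eq_one_of_ne_zero_two h2] using hA (c i) 1
      · exact hB _
    simp_rw [hfac]
    rw [Finset.prod_ite_mem, Finset.univ_inter, Finset.prod_mul_distrib, Finset.prod_const,
      Finset.prod_pow_eq_pow_sum]
    have he : ∑ j ∈ S.erase 0, (ghzRep c j : ℕ) = ∑ j ∈ S, (ghzRep c j : ℕ) :=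
      Finset.sum_erase _ (by simp [ghzRep_zero])
    rw [he]
    obtain ⟨k, hk⟩ := hS
    have hk2 : S.card / 2 = k := by omega
    rw [hk2, hk, ← two_mul, pow_mul (-Complex.I * (-1) ^ (c 0 : ℕ)) 2 k]
    -- The factors `±i` of `σ₂` pair up because `|S|` is even; this produces the term `S.card / 2`
    -- of `centralBit`.
    have hsq : (-Complex.I * (-1) ^ (c 0 : ℕ)) ^ 2 = -1 := by
      rw [mul_pow, ← pow_mul, mul_comm _ 2, pow_mul]
      simp
    rw [hsq, pow_add, pow_add, pow_add, pow_add]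
    have h00 := hcc 0
    rcases Fin.exists_fin_two.1 ⟨c 0, rfl⟩ with h | h <;> rw [h] at h00 ⊢ <;> rw [h00] <;>
      simp <;> ring
  -- Here the first bits differ while the bits at `i` agree, so the normalised strings differ at
  -- `i`.
  · push Not at hcc
    obtain ⟨i, hi⟩ := hcc
    have hii : c i = c' i := by omega
    rw [Finset.prod_eq_zero (Finset.mem_univ i) (by rw [hii, pauli_equatorial_diag])]
    have hrep : ghzRep c ≠ ghzRep c' := by
      intro h
      have := congrFun h i
      rw [ghzRep_apply, ghzRep_apply] at this
      split_ifs at this <;> omega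
    simp [hrep]

end GHZ

/-! ### The correlators of the quantum strategy -/

section QuantumCorrelation

open Matrix

/-- The matrix `Tr_E[(1 ⊗ A) ρ]`, transposed. -/
def steer (ρ : TwoQubit) (A : Matrix (Fin 2) (Fin 2) ℂ) (u v : Fin 2) : ℂ :=
  ∑ e, ∑ e', A e e' * ρ (v, e') (u, e)

/-- Independence of the sources lets the extreme parties be traced out one at a time. -/
theorem trace_kronecker_mul_jointState {n : ℕ} (ρ : Fin n → TwoQubit)
    (B : Matrix (Fin n → Fin 2) (Fin n → Fin 2) ℂ) (A : Fin n → Matrix (Fin 2) (Fin 2) ℂ) :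
    ((B ⊗ₖ tensorOp A) * jointState ρ).trace =
      ∑ c, ∑ c', B c c' * ∏ i, steer (ρ i) (A i) (c i) (c' i) := by
  simp only [Matrix.trace, Matrix.diag, Matrix.mul_apply, Fintype.sum_prod_type]
  refine Finset.sum_congr rfl fun c _ => ?_
  rw [Finset.sum_comm]
  refine Finset.sum_congr rfl fun c' _ => ?_
  simp only [steer]
  rw [Finset.prod_univ_sum, Fintype.piFinset_univ, Finset.mul_sum]
  refine Finset.sum_congr rfl fun e _ => ?_
  rw [Finset.prod_univ_sum, Fintype.piFinset_univ, Finset.mul_sum]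
  refine Finset.sum_congr rfl fun e' _ => ?_
  simp only [kroneckerMap_apply, tensorOp, jointState, Matrix.of_apply, Finset.prod_mul_distrib]
  ring

theorem sum_mul_steer (ρ : TwoQubit) (B A : Matrix (Fin 2) (Fin 2) ℂ) :
    ∑ u, ∑ v, B u v * steer ρ A u v = (ρ * (B ⊗ₖ A)).trace := by
  simp only [steer, Matrix.trace, Matrix.diag, Matrix.mul_apply, Fintype.sum_prod_type,
    Fin.sum_univ_two, kroneckerMap_apply]
  ring

/-- The half-sum of the two observables keeps only `σ₁` and the half-difference only `σ₂`. -/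
theorem sum_noisyPair_apply (η t : ℝ) (p : Prop) [Decidable p] (e e' : Fin 2) :
    (1 / 2 : ℂ) * ∑ y : Fin 2, (if p then (-1 : ℂ) ^ (y : ℕ) else 1) *
        ∑ a : Fin 2, (-1 : ℂ) ^ (a : ℕ) * noisyPair η t y a e e' =
      ((η * (if p then Real.sin t else Real.cos t) : ℝ) : ℂ) * pauli (if p then 1 else 0) e e' := by
  split_ifs <;>
    simp [noisyPair, noisyObs, Fin.sum_univ_two, -Complex.ofReal_cos, -Complex.ofReal_sin] <;> ring

theorem sum_steer_noisyPair (ρ : TwoQubit) (η t : ℝ) (p : Prop) [Decidable p] (u v : Fin 2) :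
    (1 / 2 : ℂ) * ∑ y : Fin 2, (if p then (-1 : ℂ) ^ (y : ℕ) else 1) *
        ∑ a : Fin 2, (-1 : ℂ) ^ (a : ℕ) * steer ρ (noisyPair η t y a) u v =
      ((η * (if p then Real.sin t else Real.cos t) : ℝ) : ℂ) *
        steer ρ (pauli (if p then 1 else 0)) u v := by
  have h := sum_noisyPair_apply η t p
  have h00 := h 0 0
  have h01 := h 0 1
  have h10 := h 1 0
  have h11 := h 1 1
  simp only [steer, Fin.sum_univ_two] at h00 h01 h10 h11 ⊢
  linear_combination h00 * ρ (v, 0) (u, 0) + h01 * ρ (v, 1) (u, 0) + h10 * ρ (v, 0) (u, 1) +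
    h11 * ρ (v, 1) (u, 1)

theorem trace_mul_pauli_eq_corrTensor {ρ : TwoQubit} (hρ : ρ.IsHermitian) (j k : Fin 3) :
    (ρ * (pauli j ⊗ₖ pauli k)).trace = (corrTensor ρ j k : ℂ) := by
  have h : star (ρ * (pauli j ⊗ₖ pauli k)).trace = (ρ * (pauli j ⊗ₖ pauli k)).trace := by
    rw [← trace_conjTranspose, conjTranspose_mul, conjTranspose_kronecker, hρ.eq,
      (pauli_isHermitian j).eq, (pauli_isHermitian k).eq, trace_mul_comm]
  exact (Complex.conj_eq_iff_re.1 h).symm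

theorem sum_comm_four {X M : Type*} [Fintype X] [AddCommMonoid M] (F : X → X → X → X → M) :
    ∑ x, ∑ y, ∑ z, ∑ w, F x y z w = ∑ w, ∑ x, ∑ y, ∑ z, F x y z w := by
  calc _ = ∑ x, ∑ y, ∑ w, ∑ z, F x y z w :=
        Finset.sum_congr rfl fun _ _ => Finset.sum_congr rfl fun _ _ => Finset.sum_comm
    _ = ∑ x, ∑ w, ∑ y, ∑ z, F x y z w := Finset.sum_congr rfl fun _ _ => Finset.sum_comm
    _ = _ := Finset.sum_comm

/-- Central and extreme operators are both products with the same Pauli matrix at each site, so only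
diagonal entries of the correlation tensors survive. -/
theorem starJ_quantumCorr {n : ℕ} [NeZero n] {ρ : Fin n → TwoQubit} (hρ : ∀ i, (ρ i).IsHermitian)
    (η : Fin n → ℝ) (t : ℝ) {S : Finset (Fin n)} (hS : Even S.card) :
    starJ (quantumCorr ρ fun i => noisyPair (η i) t) S =
      ∏ i, (η i * (if i ∈ S then Real.sin t * corrTensor (ρ i) 1 1
        else Real.cos t * corrTensor (ρ i) 0 0)) := by
  have hcomplex : ((starJ (quantumCorr ρ fun i => noisyPair (η i) t) S : ℝ) : ℂ).re =
      (∑ c : Fin n → Fin 2, ∑ c' : Fin n → Fin 2,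
        (1 / 2 ^ n) * ∑ x : Fin n → Fin 2, (-1 : ℂ) ^ (∑ j ∈ S, (x j : ℕ)) *
        ∑ b, ∑ a : Fin n → Fin 2, (-1 : ℂ) ^ (centralBit S b + ∑ j, (a j : ℕ)) *
          (ghzProj b c c' *
            ∏ i, steer (ρ i) (noisyPair (η i) t (x i) (a i)) (c i) (c' i))).re := by
    have hre : ∀ (k : ℕ) (z : ℂ), (-1 : ℝ) ^ k * z.re = ((-1 : ℂ) ^ k * z).re := by
      intro k z
      rw [← Complex.re_ofReal_mul]
      push_cast
      rfl
    have hre' : ∀ z : ℂ, (1 / 2 ^ n : ℝ) * z.re = ((1 / 2 ^ n) * z).re := by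
      intro z
      rw [← Complex.re_ofReal_mul]
      push_cast
      rfl
    rw [Complex.ofReal_re, starJ]
    simp only [correlator, quantumCorr, trace_kronecker_mul_jointState, hre, hre',
      ← Complex.re_sum]
    congr 1
    simp only [Finset.mul_sum]
    -- Moving `c`, then `c'`, outermost lets `star_functional_prod` be applied to each matrix entry
    -- separately.
    rw [sum_comm_four]
    refine Finset.sum_congr rfl fun c _ => ?_
    rw [sum_comm_four]
  rw [Complex.ofReal_re] at hcomplex
  rw [hcomplex]
  have hfac : ∀ c c' : Fin n → Fin 2,
      (1 / 2 ^ n) * ∑ x : Fin n → Fin 2, (-1 : ℂ) ^ (∑ j ∈ S, (x j : ℕ)) *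
        ∑ b, ∑ a : Fin n → Fin 2, (-1 : ℂ) ^ (centralBit S b + ∑ j, (a j : ℕ)) *
          (ghzProj b c c' *
            ∏ i, steer (ρ i) (noisyPair (η i) t (x i) (a i)) (c i) (c' i)) =
      ∏ i, (pauli (if i ∈ S then 1 else 0) (c i) (c' i) *
        (((η i * (if i ∈ S then Real.sin t else Real.cos t) : ℝ) : ℂ) *
        steer (ρ i) (pauli (if i ∈ S then 1 else 0)) (c i) (c' i))) := by
    intro c c'
    rw [star_functional_prod S (fun b => ghzProj b c c')
      (fun i a x => steer (ρ i) (noisyPair (η i) t x a) (c i) (c' i)),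
      sum_centralBit_ghzProj S hS, ← Finset.prod_mul_distrib]
    refine Finset.prod_congr rfl fun i _ => ?_
    rw [sum_steer_noisyPair]
  simp_rw [hfac]
  have hprod : ∀ F : Fin n → Fin 2 → Fin 2 → ℂ,
      ∑ c : Fin n → Fin 2, ∑ c' : Fin n → Fin 2, ∏ i, F i (c i) (c' i) =
        ∏ i, ∑ u, ∑ v, F i u v := by
    intro F
    rw [Finset.prod_univ_sum, Fintype.piFinset_univ]
    refine Finset.sum_congr rfl fun c _ => ?_
    rw [Finset.prod_univ_sum, Fintype.piFinset_univ]
  rw [hprod fun i u v => pauli (if i ∈ S then 1 else 0) u v *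
        (((η i * (if i ∈ S then Real.sin t else Real.cos t) : ℝ) : ℂ) *
        steer (ρ i) (pauli (if i ∈ S then 1 else 0)) u v)]
  have hone : ∀ i, ∑ u, ∑ v, pauli (if i ∈ S then 1 else 0) u v *
        (((η i * (if i ∈ S then Real.sin t else Real.cos t) : ℝ) : ℂ) *
        steer (ρ i) (pauli (if i ∈ S then 1 else 0)) u v) =
      ((η i * (if i ∈ S then Real.sin t * corrTensor (ρ i) 1 1
        else Real.cos t * corrTensor (ρ i) 0 0) : ℝ) : ℂ) := by
    intro i
    have := sum_mul_steer (ρ i) (pauli (if i ∈ S then 1 else 0)) (pauli (if i ∈ S then 1 else 0))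
    rw [trace_mul_pauli_eq_corrTensor (hρ i)] at this
    simp only [mul_left_comm (pauli _ _ _), ← Finset.mul_sum]
    rw [this, ← Complex.ofReal_mul]
    split_ifs <;> ring_nf
  simp_rw [hone]
  rw [← Complex.ofReal_prod, Complex.ofReal_re]

end QuantumCorrelation

/-! ### Real combinations of Pauli matrices -/

section PauliVectors

open Matrix

/-- The matrix `a₁ σ₁ + a₂ σ₂ + a₃ σ₃`. -/
def pauliVec (a : Fin 3 → ℝ) : Matrix (Fin 2) (Fin 2) ℂ :=
  ∑ l, (a l : ℂ) • pauli l

theorem pauliVec_eq (a : Fin 3 → ℝ) :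
    pauliVec a = !![(a 2 : ℂ), a 0 - a 1 * Complex.I; a 0 + a 1 * Complex.I, -(a 2 : ℂ)] := by
  ext i j
  fin_cases i <;> fin_cases j <;> simp [pauliVec, pauli, Fin.sum_univ_three] <;> ring

theorem pauliVec_isHermitian (a : Fin 3 → ℝ) : (pauliVec a).IsHermitian := by
  rw [pauliVec_eq]
  ext i j
  fin_cases i <;> fin_cases j <;> simp [sub_eq_add_neg]

theorem pauliVec_mul (a b : Fin 3 → ℝ) : pauliVec a * pauliVec b =
    ((a 0 * b 0 + a 1 * b 1 + a 2 * b 2 : ℝ) : ℂ) • (1 : Matrix (Fin 2) (Fin 2) ℂ) +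
      Complex.I • pauliVec ![a 1 * b 2 - a 2 * b 1, a 2 * b 0 - a 0 * b 2,
        a 0 * b 1 - a 1 * b 0] := by
  simp only [pauliVec_eq]
  ext i j
  fin_cases i <;> fin_cases j <;> simp [Matrix.mul_apply, Fin.sum_univ_two] <;>
    ring_nf <;> simp only [Complex.I_sq] <;> ring

theorem pauli_eq_pauliVec (k : Fin 3) : pauli k = pauliVec (Pi.single k 1) := by
  rw [pauliVec_eq]
  ext i j
  fin_cases k <;> fin_cases i <;> fin_cases j <;> simp [pauli]

theorem trace_pauliVec_mul_pauliVec (a b : Fin 3 → ℝ) :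
    (pauliVec a * pauliVec b).trace = ((2 * ∑ l, a l * b l : ℝ) : ℂ) := by
  rw [pauliVec_mul, trace_add, trace_smul, trace_smul, pauliVec_eq, Matrix.trace_fin_two,
    Matrix.trace_fin_two]
  simp [Fin.sum_univ_three]
  ring

theorem exists_eq_pauliVec {X : Matrix (Fin 2) (Fin 2) ℂ} (hX : X.IsHermitian)
    (hX0 : X.trace = 0) : ∃ a, X = pauliVec a := by
  refine ⟨![(X 1 0).re, (X 1 0).im, (X 0 0).re], ?_⟩
  rw [Matrix.trace_fin_two] at hX0
  have h01 : star (X 1 0) = X 0 1 := hX.apply 0 1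
  have h00 : star (X 0 0) = X 0 0 := hX.apply 0 0
  have h00' := Complex.conj_eq_iff_re.1 h00
  have h11 : X 1 1 = -X 0 0 := by linear_combination hX0
  rw [pauliVec_eq]
  ext i j
  fin_cases i <;> fin_cases j <;>
    simp [h11, ← h01, h00', Complex.re_add_im, Complex.ext_iff]

end PauliVectors

/-! ### Unitaries and rotations -/

section Rotations

open Matrix

/-- Conjugation by `U†` acts on the Pauli matrices as the matrix `R`. -/
def ActsAs (U : Matrix.unitaryGroup (Fin 2) ℂ) (R : Matrix (Fin 3) (Fin 3) ℝ) : Prop :=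
  ∀ j, (U : Matrix (Fin 2) (Fin 2) ℂ)ᴴ * pauli j * (U : Matrix (Fin 2) (Fin 2) ℂ) = pauliVec (R j)

theorem conjTranspose_mul_unitary (U : Matrix.unitaryGroup (Fin 2) ℂ) :
    (U : Matrix (Fin 2) (Fin 2) ℂ)ᴴ * (U : Matrix (Fin 2) (Fin 2) ℂ) = 1 :=
  Matrix.mem_unitaryGroup_iff'.1 U.2

theorem unitary_mul_conjTranspose (U : Matrix.unitaryGroup (Fin 2) ℂ) :
    (U : Matrix (Fin 2) (Fin 2) ℂ) * (U : Matrix (Fin 2) (Fin 2) ℂ)ᴴ = 1 :=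
  Matrix.mem_unitaryGroup_iff.1 U.2

/-- Conjugation preserves the trace form on traceless Hermitian matrices. Orthogonality alone
suffices for the invariance of singular values. -/
theorem exists_actsAs (U : Matrix.unitaryGroup (Fin 2) ℂ) :
    ∃ R : Matrix (Fin 3) (Fin 3) ℝ, R * Rᵀ = 1 ∧ ActsAs U R := by
  have h : ∀ j, ∃ a, (U : Matrix (Fin 2) (Fin 2) ℂ)ᴴ * pauli j *
      (U : Matrix (Fin 2) (Fin 2) ℂ) = pauliVec a := by
    intro j
    refine exists_eq_pauliVec (isHermitian_conjTranspose_mul_mul _ (pauli_isHermitian j)) ?_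
    rw [trace_mul_comm, ← Matrix.mul_assoc, unitary_mul_conjTranspose, Matrix.one_mul,
      Matrix.trace_fin_two]
    fin_cases j <;> simp [pauli]
  obtain ⟨R, hR⟩ : ∃ R : Matrix (Fin 3) (Fin 3) ℝ, ∀ j, (U : Matrix (Fin 2) (Fin 2) ℂ)ᴴ *
      pauli j * (U : Matrix (Fin 2) (Fin 2) ℂ) = pauliVec (R j) := Classical.axiomOfChoice h
  refine ⟨R, ?_, hR⟩
  ext j k
  have h1 := trace_pauliVec_mul_pauliVec (R j) (R k)
  rw [← hR j, ← hR k] at h1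
  have h2 : (U : Matrix (Fin 2) (Fin 2) ℂ)ᴴ * pauli j * (U : Matrix (Fin 2) (Fin 2) ℂ) *
      ((U : Matrix (Fin 2) (Fin 2) ℂ)ᴴ * pauli k * (U : Matrix (Fin 2) (Fin 2) ℂ)) =
      (U : Matrix (Fin 2) (Fin 2) ℂ)ᴴ * (pauli j * pauli k * (U : Matrix (Fin 2) (Fin 2) ℂ)) := by
    have := unitary_mul_conjTranspose U
    calc _ = (U : Matrix (Fin 2) (Fin 2) ℂ)ᴴ * (pauli j * ((U : Matrix (Fin 2) (Fin 2) ℂ) *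
          (U : Matrix (Fin 2) (Fin 2) ℂ)ᴴ) * pauli k * (U : Matrix (Fin 2) (Fin 2) ℂ)) := by
          simp only [Matrix.mul_assoc]
      _ = _ := by rw [this, Matrix.mul_one]
  rw [h2, trace_mul_comm, Matrix.mul_assoc, unitary_mul_conjTranspose, Matrix.mul_one,
    pauli_eq_pauliVec, pauli_eq_pauliVec, trace_pauliVec_mul_pauliVec, Complex.ofReal_inj] at h1
  rw [Matrix.mul_apply]
  simp only [Matrix.transpose_apply]
  have h3 : ∑ l, R j l * R k l =
      ∑ l, (Pi.single j 1 : Fin 3 → ℝ) l * (Pi.single k 1 : Fin 3 → ℝ) l := by linarith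
  rw [h3]
  simp [Pi.single_apply, Matrix.one_apply, eq_comm]

theorem eq_smul_one_of_commute {H : Matrix (Fin 2) (Fin 2) ℂ} (h0 : H * pauli 0 = pauli 0 * H)
    (h2 : H * pauli 2 = pauli 2 * H) : H = H 0 0 • (1 : Matrix (Fin 2) (Fin 2) ℂ) := by
  have a := congrFun (congrFun h0 0) 1
  have b := congrFun (congrFun h2 0) 1
  have c := congrFun (congrFun h2 1) 0
  simp [pauli, Matrix.mul_apply, Fin.sum_univ_two] at a b c
  have b' : H 0 1 = 0 := by linear_combination (-1 / 2) * b
  have c' : H 1 0 = 0 := by linear_combination (1 / 2) * c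
  ext i j
  fin_cases i <;> fin_cases j <;> simp [a, b', c']

/-- Hermitian anticommuting square roots of the identity are unitarily equivalent to `σ₁, σ₃`. -/
theorem exists_unitary_conj {A B : Matrix (Fin 2) (Fin 2) ℂ} (hA : A.IsHermitian)
    (hB : B.IsHermitian) (hA2 : A * A = 1) (hB2 : B * B = 1) (hAB : B * A = -(A * B))
    (hB0 : B.trace = 0) :
    ∃ U : Matrix.unitaryGroup (Fin 2) ℂ,
      (U : Matrix (Fin 2) (Fin 2) ℂ)ᴴ * pauli 0 * (U : Matrix (Fin 2) (Fin 2) ℂ) = A ∧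
      (U : Matrix (Fin 2) (Fin 2) ℂ)ᴴ * pauli 2 * (U : Matrix (Fin 2) (Fin 2) ℂ) = B := by
  -- `B(1 + B) = 1 + B`, so any nonzero column of `1 + B` is fixed by `B`; one exists since the
  -- trace of `1 + B` is `2`.
  obtain ⟨e, he0, he⟩ : ∃ e : Fin 2 → ℂ, e ≠ 0 ∧ B *ᵥ e = e := by
    have hne : (1 + B) ≠ 0 := fun h => by
      have := congrArg Matrix.trace h
      rw [trace_add, hB0] at this
      simp at this
    obtain ⟨k, hk⟩ : ∃ k, (1 + B).col k ≠ 0 := by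
      by_contra! h
      exact hne (by ext i j; exact congrFun (h j) i)
    refine ⟨_, hk, ?_⟩
    have : B * (1 + B) = 1 + B := by rw [mul_add, hB2, mul_one, add_comm]
    rw [← Matrix.mulVec_single_one, Matrix.mulVec_mulVec, this]
  set f := A *ᵥ e with hf
  have hAf : A *ᵥ f = e := by rw [hf, Matrix.mulVec_mulVec, hA2, Matrix.one_mulVec]
  have hBf : B *ᵥ f = -f := by
    rw [hf, Matrix.mulVec_mulVec, hAB, Matrix.neg_mulVec, ← Matrix.mulVec_mulVec, he]
  let V : Matrix (Fin 2) (Fin 2) ℂ := Matrix.of fun i j => if j = 0 then e i else f i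
  have hVA : A * V = V * pauli 0 := by
    ext i j
    have h1 := congrFun hf i
    have h2 := congrFun hAf i
    simp only [Matrix.mulVec, dotProduct, Fin.sum_univ_two] at h1 h2
    fin_cases j <;> simp [V, Matrix.mul_apply, Fin.sum_univ_two, pauli, h1, h2]
  have hVB : B * V = V * pauli 2 := by
    ext i j
    have h1 := congrFun he i
    have h2 := congrFun hBf i
    simp only [Matrix.mulVec, dotProduct, Fin.sum_univ_two] at h1 h2
    fin_cases j <;> simp [V, Matrix.mul_apply, Fin.sum_univ_two, pauli, h1, h2]
  -- The Gram matrix of the columns `e`, `A e` commutes with `σ₁` and `σ₃`, hence is scalar: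
  -- rescaling `V` makes it unitary.
  have hcomm : ∀ {C : Matrix (Fin 2) (Fin 2) ℂ} {k : Fin 3}, C.IsHermitian → C * V = V * pauli k →
      Vᴴ * V * pauli k = pauli k * (Vᴴ * V) := by
    intro C k hC h
    have h' := congrArg conjTranspose h
    rw [conjTranspose_mul, conjTranspose_mul, hC.eq, (pauli_isHermitian k).eq] at h'
    rw [Matrix.mul_assoc, ← h, ← Matrix.mul_assoc, h', Matrix.mul_assoc]
  have hH := eq_smul_one_of_commute (hcomm hA hVA) (hcomm hB hVB)
  set c : ℝ := ‖e 0‖ ^ 2 + ‖e 1‖ ^ 2 with hc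
  have hc00 : (Vᴴ * V) 0 0 = (c : ℂ) := by
    simp only [Matrix.mul_apply, Fin.sum_univ_two, conjTranspose_apply, V, Matrix.of_apply, if_true,
      hc, RCLike.star_def, Complex.conj_mul']
    push_cast
    rfl
  have hcpos : 0 < c := by
    rcases ne_or_eq (e 0) 0 with h | h
    · have := norm_pos_iff.2 h
      positivity
    · have h1 : e 1 ≠ 0 := fun h1 => he0 (by ext i; fin_cases i <;> simp [h, h1])
      have := norm_pos_iff.2 h1
      positivity
  rw [hc00] at hH
  let W : Matrix (Fin 2) (Fin 2) ℂ := ((√c)⁻¹ : ℝ) • V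
  have hW : Wᴴ * W = 1 := by
    simp only [W, conjTranspose_smul, smul_mul_assoc, mul_smul_comm, hH, star_trivial]
    rw [smul_smul, ← mul_inv, Real.mul_self_sqrt hcpos.le, Complex.coe_smul, smul_smul,
      inv_mul_cancel₀ hcpos.ne', one_smul]
  have hW' : W * Wᴴ = 1 := mul_eq_one_comm.1 hW
  have hconj : ∀ {C : Matrix (Fin 2) (Fin 2) ℂ} {k : Fin 3}, C * V = V * pauli k →
      Wᴴᴴ * pauli k * Wᴴ = C := by
    intro C k h
    have : C * W = W * pauli k := by simp only [W, mul_smul_comm, smul_mul_assoc, h]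
    rw [conjTranspose_conjTranspose, ← this, Matrix.mul_assoc, hW', Matrix.mul_one]
  exact ⟨⟨Wᴴ, Matrix.mem_unitaryGroup_iff.2 (by
    rw [star_eq_conjTranspose, conjTranspose_conjTranspose, hW])⟩, hconj hVA, hconj hVB⟩

/-- Every rotation is induced by a unitary. -/
theorem exists_unitary_actsAs {R : Matrix (Fin 3) (Fin 3) ℝ} (hR : R * Rᵀ = 1) (hdet : R.det = 1) :
    ∃ U, ActsAs U R := by
  have hdot : ∀ j k, R j 0 * R k 0 + R j 1 * R k 1 + R j 2 * R k 2 =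
      (1 : Matrix (Fin 3) (Fin 3) ℝ) j k := by
    intro j k
    rw [← hR, Matrix.mul_apply, Fin.sum_univ_three]
    rfl
  have hadj : R.adjugate = Rᵀ := by
    have h1 : Rᵀ * R = 1 := mul_eq_one_comm.1 hR
    calc R.adjugate = Rᵀ * (R * R.adjugate) := by rw [← Matrix.mul_assoc, h1, Matrix.one_mul]
      _ = Rᵀ := by rw [Matrix.mul_adjugate, hdet, one_smul, Matrix.mul_one]
  -- Determinant `1` makes this row the cross product of the other two. Since `σ₂ = i σ₁ σ₃`,
  -- matching `σ₁` and `σ₃` is then enough.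
  have hcross : R 1 = ![R 2 1 * R 0 2 - R 2 2 * R 0 1, R 2 2 * R 0 0 - R 2 0 * R 0 2,
      R 2 0 * R 0 1 - R 2 1 * R 0 0] := by
    rw [Matrix.adjugate_fin_three] at hadj
    have a0 := congrFun (congrFun hadj 0) 1
    have a1 := congrFun (congrFun hadj 1) 1
    have a2 := congrFun (congrFun hadj 2) 1
    simp at a0 a1 a2
    ext i
    fin_cases i <;> simp <;> linarith
  have hone : pauliVec (R 1) = Complex.I • (pauliVec (R 0) * pauliVec (R 2)) := by
    rw [pauliVec_mul, hdot, hcross]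
    simp only [pauliVec_eq]
    ext i j
    fin_cases i <;> fin_cases j <;> simp [← mul_assoc] <;> ring
  have hpauli : pauli 1 = Complex.I • (pauli 0 * pauli 2) := by
    ext i j
    fin_cases i <;> fin_cases j <;> simp [pauli]
  have hsq : ∀ j, pauliVec (R j) * pauliVec (R j) = 1 := by
    intro j
    rw [pauliVec_mul, hdot]
    simp only [pauliVec_eq]
    ext i k
    fin_cases i <;> fin_cases k <;> simp [mul_comm]
  have hanti : pauliVec (R 2) * pauliVec (R 0) = -(pauliVec (R 0) * pauliVec (R 2)) := by
    rw [pauliVec_mul, pauliVec_mul, hdot, hdot]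
    simp only [pauliVec_eq]
    ext i k
    fin_cases i <;> fin_cases k <;> simp <;> ring
  obtain ⟨U, h0, h2⟩ := exists_unitary_conj (pauliVec_isHermitian (R 0))
    (pauliVec_isHermitian (R 2)) (hsq 0) (hsq 2) hanti (by
      rw [pauliVec_eq, Matrix.trace_fin_two]; simp)
  refine ⟨U, fun j => ?_⟩
  fin_cases j
  · exact h0
  · change _ = pauliVec (R 1)
    rw [hone, ← h0, ← h2]
    have := unitary_mul_conjTranspose U
    calc _ = Complex.I • ((U : Matrix (Fin 2) (Fin 2) ℂ)ᴴ * (pauli 0 * pauli 2) *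
          (U : Matrix (Fin 2) (Fin 2) ℂ)) := by
          change (U : Matrix (Fin 2) (Fin 2) ℂ)ᴴ * pauli 1 * (U : Matrix (Fin 2) (Fin 2) ℂ) = _
          rw [hpauli, Matrix.mul_smul, Matrix.smul_mul]
      _ = Complex.I • ((U : Matrix (Fin 2) (Fin 2) ℂ)ᴴ * (pauli 0 *
          ((U : Matrix (Fin 2) (Fin 2) ℂ) * (U : Matrix (Fin 2) (Fin 2) ℂ)ᴴ) * pauli 2) *
          (U : Matrix (Fin 2) (Fin 2) ℂ)) := by rw [this, Matrix.mul_one]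
      _ = _ := by simp only [Matrix.mul_assoc]
  · exact h2

theorem corrTensor_localRotate {U W : Matrix.unitaryGroup (Fin 2) ℂ}
    {R Q : Matrix (Fin 3) (Fin 3) ℝ} (hU : ActsAs U R) (hW : ActsAs W Q) (ρ : TwoQubit) :
    corrTensor (localRotate U W ρ) = R * corrTensor ρ * Qᵀ := by
  ext j k
  set K := (U : Matrix (Fin 2) (Fin 2) ℂ) ⊗ₖ (W : Matrix (Fin 2) (Fin 2) ℂ) with hK
  have h1 : (localRotate U W ρ * (pauli j ⊗ₖ pauli k)).trace =
      (ρ * (pauliVec (R j) ⊗ₖ pauliVec (Q k))).trace := by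
    rw [← hU j, ← hW k, Matrix.mul_kronecker_mul, Matrix.mul_kronecker_mul,
      ← conjTranspose_kronecker, localRotate, ← hK]
    calc _ = (K * (ρ * Kᴴ * (pauli j ⊗ₖ pauli k))).trace := by simp only [Matrix.mul_assoc]
      _ = _ := by rw [trace_mul_comm]; simp only [Matrix.mul_assoc]
  have h2 : pauliVec (R j) ⊗ₖ pauliVec (Q k) =
      ∑ l, ∑ m, ((R j l * Q k m : ℝ) : ℂ) • (pauli l ⊗ₖ pauli m) := by
    ext a b
    simp only [pauliVec, Matrix.sum_apply, kroneckerMap_apply, Matrix.smul_apply, smul_eq_mul,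
      Finset.sum_mul_sum, Complex.ofReal_mul]
    exact Finset.sum_congr rfl fun _ _ => Finset.sum_congr rfl fun _ _ => by ring
  simp only [corrTensor, Matrix.of_apply, h1, h2, Matrix.mul_sum, trace_sum, Complex.re_sum,
    Matrix.mul_smul, trace_smul, smul_eq_mul, Complex.re_ofReal_mul, Matrix.mul_apply,
    Finset.sum_mul, Matrix.transpose_apply]
  rw [Finset.sum_comm]
  exact Finset.sum_congr rfl fun _ _ => Finset.sum_congr rfl fun _ _ => by ring

end Rotations

/-! ### Singular values and the canonical form -/

section SingularValues

open Matrix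

theorem singularValues_eq_of_charpoly_eq {m : ℕ} {A B : Matrix (Fin m) (Fin m) ℝ}
    (h : (Aᵀ * A).charpoly = (Bᵀ * B).charpoly) (k : Fin m) :
    (toEuclideanLin A).singularValues k = (toEuclideanLin B).singularValues k := by
  have hadj : ∀ C : Matrix (Fin m) (Fin m) ℝ,
      LinearMap.adjoint (toEuclideanLin C) ∘ₗ toEuclideanLin C = toEuclideanLin (Cᵀ * C) := by
    intro C
    rw [← toEuclideanLin_conjTranspose_eq_adjoint, conjTranspose_eq_transpose_of_trivial,
      toLpLin_mul_same]
  have hchar : ∀ C : Matrix (Fin m) (Fin m) ℝ, (toEuclideanLin C).charpoly = C.charpoly := by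
    intro C
    rw [toEuclideanLin_eq_toLin_orthonormal, charpoly_toLin]
  rw [LinearMap.singularValues_fin _ (finrank_euclideanSpace_fin (𝕜 := ℝ) (n := m)),
    LinearMap.singularValues_fin _ (finrank_euclideanSpace_fin (𝕜 := ℝ) (n := m)),
    ((toEuclideanLin A).isSymmetric_adjoint_comp_self.eigenvalues_eq_eigenvalues_iff _
      (toEuclideanLin B).isSymmetric_adjoint_comp_self _).2]
  rw [hadj, hadj, hchar, hchar, h]

theorem singularValues_orthogonal_mul_mul {m : ℕ} {R Q : Matrix (Fin m) (Fin m) ℝ}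
    (hR : R * Rᵀ = 1) (hQ : Q * Qᵀ = 1) (A : Matrix (Fin m) (Fin m) ℝ) (k : Fin m) :
    (toEuclideanLin (R * A * Qᵀ)).singularValues k = (toEuclideanLin A).singularValues k := by
  refine singularValues_eq_of_charpoly_eq ?_ k
  have hR' : Rᵀ * R = 1 := mul_eq_one_comm.1 hR
  have hQ' : Qᵀ * Q = 1 := mul_eq_one_comm.1 hQ
  have : (R * A * Qᵀ)ᵀ * (R * A * Qᵀ) = Q * (Aᵀ * A * Qᵀ) := by
    simp only [transpose_mul, transpose_transpose]
    calc _ = Q * (Aᵀ * (Rᵀ * R) * A * Qᵀ) := by simp only [Matrix.mul_assoc]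
      _ = _ := by rw [hR', Matrix.mul_one]
  rw [this, charpoly_mul_comm, Matrix.mul_assoc, hQ', Matrix.mul_one]

/-- Singular value decomposition of a square real matrix. -/
theorem exists_orthogonal_diagonal_singularValues {m : ℕ} (A : Matrix (Fin m) (Fin m) ℝ) :
    ∃ P Q : Matrix (Fin m) (Fin m) ℝ, P * Pᵀ = 1 ∧ Q * Qᵀ = 1 ∧
      P * A * Qᵀ = diagonal fun k : Fin m => (toEuclideanLin A).singularValues k := by
  set L := toEuclideanLin A with hL
  have hfr := finrank_euclideanSpace_fin (𝕜 := ℝ) (n := m)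
  let b := L.isSymmetric_adjoint_comp_self.eigenvectorBasis hfr
  let σ : Fin m → ℝ := fun k => L.singularValues k
  have hinner : ∀ i j, inner ℝ (L (b i)) (L (b j)) = if i = j then σ i ^ 2 else 0 := by
    intro i j
    have h1 : LinearMap.adjoint L (L (b j)) = (σ j ^ 2) • b j := by
      have := L.isSymmetric_adjoint_comp_self.apply_eigenvectorBasis hfr j
      rw [← L.sq_singularValues_fin hfr j] at this
      exact this
    rw [← LinearMap.adjoint_inner_right, h1, inner_smul_right, b.inner_eq_ite]
    split_ifs with h
    · rw [h, mul_one]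
    · rw [mul_zero]
  -- Only the vectors with `σ k ≠ 0` are kept; they are completed to an orthonormal basis, and `L (b
  -- k) = 0` for the other indices.
  let v : Fin m → EuclideanSpace ℝ (Fin m) := fun k => (σ k)⁻¹ • L (b k)
  have hv : Orthonormal ℝ (Set.domRestrict {k | σ k ≠ 0} v) := by
    rw [orthonormal_iff_ite]
    rintro ⟨i, hi⟩ ⟨j, hj⟩
    simp only [Set.mem_ofPred_eq] at hi hj
    simp only [Set.domRestrict_apply, v, inner_smul_left, inner_smul_right, hinner, Subtype.mk.injEq]
    split_ifs with h
    · subst h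
      simp
      field_simp
    · simp
  obtain ⟨u, hu⟩ := hv.exists_orthonormalBasis_extension_of_card_eq (by simp)
  have hLb : ∀ k, L (b k) = σ k • u k := by
    intro k
    by_cases hk : σ k = 0
    · have := hinner k k
      rw [if_pos rfl, hk, zero_pow two_ne_zero, inner_self_eq_zero] at this
      rw [this, hk, zero_smul]
    · rw [hu k hk, smul_smul, mul_inv_cancel₀ hk, one_smul]
  have horth : ∀ w : OrthonormalBasis (Fin m) ℝ (EuclideanSpace ℝ (Fin m)),
      (Matrix.of fun i j => w i j) *
        (Matrix.of fun i j => w i j : Matrix (Fin m) (Fin m) ℝ)ᵀ = 1 := by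
    intro w
    ext i j
    have := w.inner_eq_ite j i
    rw [PiLp.inner_apply] at this
    simp only [Matrix.mul_apply, Matrix.transpose_apply, Matrix.of_apply, Matrix.one_apply]
    simpa [eq_comm] using this
  refine ⟨Matrix.of fun i j => u i j, Matrix.of fun i j => b i j, horth u, horth b, ?_⟩
  ext i j
  have h1 : (A * (Matrix.of fun i j => b i j : Matrix (Fin m) (Fin m) ℝ)ᵀ) =
      (Matrix.of fun i j => u i j : Matrix (Fin m) (Fin m) ℝ)ᵀ * diagonal σ := by
    ext p q
    have := congrFun (congrArg WithLp.ofLp (hLb q)) p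
    rw [hL, ofLp_toLpLin] at this
    rw [mul_diagonal]
    simp only [Matrix.mul_apply, Matrix.transpose_apply, Matrix.of_apply]
    simpa [Matrix.mulVec, dotProduct, mul_comm] using this
  rw [Matrix.mul_assoc, h1, ← Matrix.mul_assoc, horth u, Matrix.one_mul]

/-- Singular value decomposition of a real `3 × 3` matrix by rotations. -/
theorem exists_rotation_diagonal_singularValues (A : Matrix (Fin 3) (Fin 3) ℝ) :
    ∃ P Q : Matrix (Fin 3) (Fin 3) ℝ, P * Pᵀ = 1 ∧ P.det = 1 ∧ Q * Qᵀ = 1 ∧ Q.det = 1 ∧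
      ∃ ε : ℝ, (ε = 1 ∨ ε = -1) ∧ P * A * Qᵀ = diagonal
        ![(toEuclideanLin A).singularValues 0, (toEuclideanLin A).singularValues 1,
          ε * (toEuclideanLin A).singularValues 2] := by
  obtain ⟨P, Q, hP, hQ, h⟩ := exists_orthogonal_diagonal_singularValues A
  have hdet : ∀ R : Matrix (Fin 3) (Fin 3) ℝ, R * Rᵀ = 1 → R.det = 1 ∨ R.det = -1 := by
    intro R hR
    have := congrArg det hR
    rw [det_mul, det_transpose, det_one] at this
    exact mul_self_eq_one_iff.1 this
  -- Flipping the third axis corrects a determinant `-1`, at the cost of a sign on the third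
  -- singular value only.
  let F : ℝ → Matrix (Fin 3) (Fin 3) ℝ := fun δ => diagonal ![1, 1, δ]
  have hFt : ∀ δ, (F δ)ᵀ = F δ := fun δ => diagonal_transpose _
  have hFdet : ∀ δ, (F δ).det = δ := fun δ => by
    simp [F, det_diagonal, Fin.prod_univ_three]
  have hF2 : ∀ δ, δ * δ = 1 → F δ * F δ = 1 := fun δ hδ => by
    simp only [F, diagonal_mul_diagonal]
    rw [← diagonal_one]
    congr 1
    ext i
    fin_cases i <;> simp [hδ]
  have hF : ∀ R : Matrix (Fin 3) (Fin 3) ℝ, R * Rᵀ = 1 →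
      (F R.det * R) * (F R.det * R)ᵀ = 1 ∧ (F R.det * R).det = 1 := by
    intro R hR
    have hd : R.det * R.det = 1 := mul_self_eq_one_iff.2 (hdet R hR)
    refine ⟨?_, ?_⟩
    · rw [transpose_mul, hFt]
      calc _ = F R.det * (R * Rᵀ) * F R.det := by simp only [Matrix.mul_assoc]
        _ = 1 := by rw [hR, Matrix.mul_one, hF2 _ hd]
    · rw [det_mul, hFdet, hd]
  refine ⟨F P.det * P, F Q.det * Q, (hF P hP).1, (hF P hP).2, (hF Q hQ).1, (hF Q hQ).2,
    P.det * Q.det, ?_, ?_⟩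
  · rcases hdet P hP with hp | hp <;> rcases hdet Q hQ with hq | hq <;> simp [hp, hq]
  · rw [transpose_mul, hFt]
    calc _ = F P.det * (P * A * Qᵀ) * F Q.det := by simp only [Matrix.mul_assoc]
      _ = _ := by
        rw [h]
        simp only [F, diagonal_mul_diagonal]
        congr 1
        ext i
        fin_cases i <;> simp
        ring

theorem singVal_localRotate (U W : Matrix.unitaryGroup (Fin 2) ℂ) (ρ : TwoQubit) (k : Fin 3) :
    singVal (localRotate U W ρ) k = singVal ρ k := by
  obtain ⟨R, hR, hUR⟩ := exists_actsAs U
  obtain ⟨Q, hQ, hWQ⟩ := exists_actsAs W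
  rw [singVal, corrTensor_localRotate hUR hWQ]
  exact singularValues_orthogonal_mul_mul hR hQ _ k

theorem singVal_nonneg (ρ : TwoQubit) (k : Fin 3) : 0 ≤ singVal ρ k :=
  LinearMap.singularValues_nonneg _ _

theorem exists_isCanonical_localRotate (ρ : TwoQubit) :
    ∃ U W : Matrix.unitaryGroup (Fin 2) ℂ, IsCanonical (localRotate U W ρ) := by
  obtain ⟨P, Q, hP, hPd, hQ, hQd, ε, hε, h⟩ :=
    exists_rotation_diagonal_singularValues (corrTensor ρ)
  obtain ⟨U, hU⟩ := exists_unitary_actsAs hP hPd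
  obtain ⟨W, hW⟩ := exists_unitary_actsAs hQ hQd
  refine ⟨U, W, ε, hε, ?_⟩
  rw [corrTensor_localRotate hU hW, h, singVal_localRotate, singVal_localRotate,
    singVal_localRotate]
  rfl

theorem isState_localRotate {ρ : TwoQubit} (hρ : IsState ρ) (U W : Matrix.unitaryGroup (Fin 2) ℂ) :
    IsState (localRotate U W ρ) := by
  refine ⟨hρ.1.mul_mul_conjTranspose_same _, ?_⟩
  rw [localRotate, Matrix.mul_assoc, trace_mul_comm, Matrix.mul_assoc, conjTranspose_kronecker,
    ← mul_kronecker_mul, conjTranspose_mul_unitary, conjTranspose_mul_unitary, one_kronecker_one,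
    Matrix.mul_one, hρ.2]

theorem corrTensor_le_one {ρ : TwoQubit} (hρ : IsState ρ) (j k : Fin 3) : corrTensor ρ j k ≤ 1 := by
  have h := abs_re_trace_mul_le (A := pauli j ⊗ₖ pauli k) (G := ρ)
    (by rw [IsHermitian, conjTranspose_kronecker, (pauli_isHermitian j).eq,
      (pauli_isHermitian k).eq])
    (by rw [← mul_kronecker_mul, pauli_mul_self, pauli_mul_self, one_kronecker_one]) hρ.1
  rw [trace_mul_comm, hρ.2, Complex.one_re] at h
  exact (abs_le.1 h).2

theorem corrTensor_zero_zero_of_isCanonical {ρ : TwoQubit} (h : IsCanonical ρ) :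
    corrTensor ρ 0 0 = singVal ρ 0 := by
  obtain ⟨ε, -, h⟩ := h
  rw [h, diagonal_apply_eq]
  rfl

theorem corrTensor_one_one_of_isCanonical {ρ : TwoQubit} (h : IsCanonical ρ) :
    corrTensor ρ 1 1 = singVal ρ 1 := by
  obtain ⟨ε, -, h⟩ := h
  rw [h, diagonal_apply_eq]
  rfl

/-- The singular value decomposition gives a diagonal matrix of square `1` with nonnegative entries.
It serves for the Bell state, whose tensor `diag(1, -1, 1)` is not canonical. -/
theorem singVal_eq_one_of_orthogonal {ρ : TwoQubit}
    (h : (corrTensor ρ)ᵀ * corrTensor ρ = 1) (k : Fin 3) : singVal ρ k = 1 := by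
  obtain ⟨P, Q, hP, hQ, hd⟩ := exists_orthogonal_diagonal_singularValues (corrTensor ρ)
  have hP' : Pᵀ * P = 1 := mul_eq_one_comm.1 hP
  have h2 : (diagonal fun k : Fin 3 => singVal ρ k) *
      (diagonal fun k : Fin 3 => singVal ρ k) = 1 := by
    have ht : (diagonal fun k : Fin 3 => singVal ρ k) = P * corrTensor ρ * Qᵀ := hd.symm
    nth_rewrite 1 [← diagonal_transpose]
    rw [ht]
    simp only [transpose_mul, transpose_transpose]
    calc _ = Q * ((corrTensor ρ)ᵀ * (Pᵀ * P) * corrTensor ρ) * Qᵀ := by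
          simp only [Matrix.mul_assoc]
      _ = 1 := by rw [hP', Matrix.mul_one, h, Matrix.mul_one, hQ]
  have h3 := congrFun (congrFun h2 k) k
  rw [diagonal_mul_diagonal, diagonal_apply_eq, one_apply_eq] at h3
  nlinarith [singVal_nonneg ρ k]

/-- The Bell state `(|00⟩ + |11⟩) / √2`. -/
noncomputable def bellState : TwoQubit :=
  (1 / 2 : ℝ) • vecMulVec (fun s => if s.1 = s.2 then 1 else 0)
    (star fun s => if s.1 = s.2 then 1 else 0)

theorem isState_bellState : IsState bellState := by
  refine ⟨(posSemidef_vecMulVec_self_star _).smul (by norm_num), ?_⟩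
  simp [bellState, Matrix.trace, vecMulVec_apply, Fintype.sum_prod_type]

theorem singVal_bellState (k : Fin 3) : singVal bellState k = 1 := by
  refine singVal_eq_one_of_orthogonal ?_ k
  have h : corrTensor bellState = diagonal ![1, -1, 1] := by
    ext i j
    fin_cases i <;> fin_cases j <;>
      simp [corrTensor, bellState, Matrix.trace, Matrix.mul_apply, vecMulVec_apply,
        Fintype.sum_prod_type, Fin.sum_univ_two, pauli] <;> norm_num
  rw [h, diagonal_transpose, diagonal_mul_diagonal, ← diagonal_one]
  congr 1
  ext i
  fin_cases i <;> simp

end SingularValues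

/-! ### The source condition, the angle and the noiseless value -/

section SourceCondition

variable {n : ℕ} {E : Fin n → Fin 3 → ℝ}

theorem gSum_eq_sum_finset (E : Fin n → Fin 3 → ℝ) (k : ℕ) :
    gSum E k = ∑ S : Finset (Fin n) with S.card = k,
      ∏ i, (if i ∈ S then E i 1 else E i 0) ^ (1 / (n : ℝ)) := by
  refine Finset.sum_nbij' (fun h => Finset.univ.filter fun i => h i = 1)
    (fun S i => if i ∈ S then 1 else 0) ?_ ?_ ?_ ?_ ?_
  · intro h hh
    simpa using hh
  · intro S hS
    simpa using hS
  · intro h _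
    funext i
    by_cases hi : h i = 1
    · simp [hi]
    · simp only [Finset.mem_filter, Finset.mem_univ, true_and, hi, if_false]
      omega
  · intro S _
    ext i
    simp
  · intro h _
    refine Finset.prod_congr rfl fun i _ => ?_
    by_cases hi : h i = 1
    · simp [hi]
    · have : h i = 0 := by omega
      simp [this]

/-- Grouping even sets by size matches `Σ` with the sum over `S` in the star inequality. -/
theorem evenSum_eq_sum_finset (E : Fin n → Fin 3 → ℝ) :
    evenSum E = ∑ S : Finset (Fin n) with Even S.card,
      (∏ i, E i 0 ^ (n - S.card) * E i 1 ^ S.card) ^ (1 / (n : ℝ) ^ 3) *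
        ∏ i, (if i ∈ S then E i 1 else E i 0) ^ (1 / (n : ℝ)) := by
  have hmaps : ∀ S ∈ (Finset.univ : Finset (Finset (Fin n))).filter (fun S => Even S.card),
      S.card ∈ (Finset.range (n + 1)).filter (fun k => Even k) := by
    intro S hS
    simp only [Finset.mem_filter, Finset.mem_univ, true_and, Finset.mem_range] at hS ⊢
    have := Finset.card_le_univ S
    rw [Fintype.card_fin] at this
    exact ⟨by omega, hS⟩
  rw [← Finset.sum_fiberwise_of_maps_to hmaps, evenSum]
  refine Finset.sum_congr rfl fun k hk => ?_
  rw [gSum_eq_sum_finset, Finset.mul_sum, Finset.filter_filter]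
  have hset : (Finset.univ.filter fun S : Finset (Fin n) => S.card = k) =
      Finset.univ.filter fun S : Finset (Fin n) => Even S.card ∧ S.card = k := by
    refine Finset.filter_congr fun S _ => ⟨fun h => ⟨?_, h⟩, fun h => h.2⟩
    rw [h]
    exact (Finset.mem_filter.1 hk).2
  rw [← hset]
  refine Finset.sum_congr rfl fun S hS => ?_
  rw [(Finset.mem_filter.1 hS).2]

theorem prodPow_nonneg (hE : ∀ i k, 0 ≤ E i k) (k : Fin 3) (s : ℝ) : 0 ≤ prodPow E k s :=
  Finset.prod_nonneg fun i _ => Real.rpow_nonneg (hE i k) _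

theorem prodPow_two_div (hE : ∀ i k, 0 ≤ E i k) (k : Fin 3) :
    prodPow E k (2 / (n : ℝ) ^ 2) = prodPow E k (1 / (n : ℝ) ^ 2) ^ 2 := by
  rw [prodPow, prodPow, ← Finset.prod_pow]
  refine Finset.prod_congr rfl fun i _ => ?_
  rw [← Real.rpow_mul_natCast (hE i k)]
  congr 1
  push_cast
  ring

theorem evenSum_nonneg (hE : ∀ i k, 0 ≤ E i k) : 0 ≤ evenSum E := by
  rw [evenSum_eq_sum_finset]
  refine Finset.sum_nonneg fun S _ => mul_nonneg (Real.rpow_nonneg ?_ _)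
    (Finset.prod_nonneg fun i _ => Real.rpow_nonneg ?_ _)
  · exact Finset.prod_nonneg fun i _ => mul_nonneg (pow_nonneg (hE i 0) _) (pow_nonneg (hE i 1) _)
  · split_ifs
    exacts [hE i 1, hE i 0]

theorem evenSum_pos_of_sourceCondition (hn : n ≠ 0) (hE : ∀ i k, 0 ≤ E i k)
    (h : SourceCondition E) : 0 < evenSum E := by
  refine (evenSum_nonneg hE).lt_of_ne fun h0 => ?_
  rw [SourceCondition, ← h0, mul_zero, zero_pow hn] at h
  refine absurd h (not_lt.2 (mul_nonneg (mul_nonneg (by positivity) (Real.sqrt_nonneg _))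
    (pow_nonneg (add_nonneg (prodPow_nonneg hE _ _) (prodPow_nonneg hE _ _)) _)))

theorem pos_of_evenSum_pos (hE : ∀ i k, 0 ≤ E i k) (hE10 : ∀ i, E i 1 ≤ E i 0)
    (h : 0 < evenSum E) (i : Fin n) : 0 < E i 0 := by
  refine (hE i 0).lt_of_ne fun h0 => h.ne' ?_
  have h1 : E i 1 = 0 := le_antisymm (h0 ▸ hE10 i) (hE i 1)
  have hn : 0 < n := i.pos
  rw [evenSum_eq_sum_finset]
  refine Finset.sum_eq_zero fun S _ => ?_
  rw [Finset.prod_eq_zero (Finset.mem_univ i), Real.zero_rpow (by positivity), zero_mul]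
  -- The two exponents add up to at least `n > 0`, so the convention `0 ^ 0 = 1` does no harm.
  rw [← h0, h1, ← pow_add]
  exact zero_pow (by omega)

theorem normFactor_eq (hE : ∀ i k, 0 ≤ E i k) : normFactor E =
    √(prodPow E 0 (1 / (n : ℝ) ^ 2) ^ 2 + prodPow E 1 (1 / (n : ℝ) ^ 2) ^ 2) := by
  rw [normFactor, prodPow_two_div hE, prodPow_two_div hE]

theorem normFactor_pos (hE : ∀ i k, 0 ≤ E i k) (hE0 : ∀ i, 0 < E i 0) : 0 < normFactor E := by
  rw [normFactor_eq hE]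
  have : 0 < prodPow E 0 (1 / (n : ℝ) ^ 2) :=
    Finset.prod_pos fun i _ => Real.rpow_pos_of_pos (hE0 i) _
  positivity

theorem sin_angle (hE : ∀ i k, 0 ≤ E i k) :
    Real.sin (angle E) = prodPow E 1 (1 / (n : ℝ) ^ 2) / normFactor E := by
  have ha := prodPow_nonneg hE 0 (1 / (n : ℝ) ^ 2)
  have hb := prodPow_nonneg hE 1 (1 / (n : ℝ) ^ 2)
  rw [angle, normFactor_eq hE, prodPow_two_div hE, prodPow_two_div hE, Real.sin_arcsin,
    Real.sqrt_div (by positivity), Real.sqrt_sq hb]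
  · exact le_trans (by norm_num) (Real.sqrt_nonneg _)
  · refine Real.sqrt_le_one.2 ?_
    exact div_le_one_of_le₀ (le_add_of_nonneg_left (by positivity)) (by positivity)

theorem cos_angle (hE : ∀ i k, 0 ≤ E i k) (hE0 : ∀ i, 0 < E i 0) :
    Real.cos (angle E) = prodPow E 0 (1 / (n : ℝ) ^ 2) / normFactor E := by
  have ha := prodPow_nonneg hE 0 (1 / (n : ℝ) ^ 2)
  have hN := normFactor_pos hE hE0
  have hc : 0 ≤ Real.cos (angle E) := Real.cos_arcsin_nonneg _
  have hs := sin_angle hE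
  have hN2 : normFactor E ^ 2 =
      prodPow E 0 (1 / (n : ℝ) ^ 2) ^ 2 + prodPow E 1 (1 / (n : ℝ) ^ 2) ^ 2 := by
    rw [normFactor_eq hE, Real.sq_sqrt (by positivity)]
  rw [← sq_eq_sq₀ hc (by positivity), Real.cos_sq', hs, div_pow, div_pow, eq_div_iff (by positivity),
    sub_mul, div_mul_cancel₀ _ (by positivity), hN2]
  ring

theorem prod_pow_mul_pow_rpow (hE : ∀ i k, 0 ≤ E i k) (p q : ℕ) :
    (∏ i, E i 0 ^ p * E i 1 ^ q) ^ (1 / (n : ℝ) ^ 3) =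
      (prodPow E 0 (1 / (n : ℝ) ^ 2) ^ p * prodPow E 1 (1 / (n : ℝ) ^ 2) ^ q) ^ (1 / (n : ℝ)) := by
  have h0 : ∀ i, 0 ≤ E i 0 ^ p * E i 1 ^ q := fun i =>
    mul_nonneg (pow_nonneg (hE i 0) _) (pow_nonneg (hE i 1) _)
  have h1 : prodPow E 0 (1 / (n : ℝ) ^ 2) ^ p * prodPow E 1 (1 / (n : ℝ) ^ 2) ^ q =
      (∏ i, E i 0 ^ p * E i 1 ^ q) ^ (1 / (n : ℝ) ^ 2) := by
    rw [← Real.finsetProd_rpow _ _ fun i _ => h0 i, prodPow, prodPow, ← Finset.prod_pow,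
      ← Finset.prod_pow, ← Finset.prod_mul_distrib]
    refine Finset.prod_congr rfl fun i _ => ?_
    rw [Real.mul_rpow (pow_nonneg (hE i 0) _) (pow_nonneg (hE i 1) _),
      Real.rpow_pow_comm (hE i 0), Real.rpow_pow_comm (hE i 1)]
  rw [h1, ← Real.rpow_mul (Finset.prod_nonneg fun i _ => h0 i)]
  congr 1
  rw [div_mul_div_comm, one_mul, ← pow_succ]

/-- The sum over the even sets of the noiseless correlators. -/
theorem sum_even_angle (hn : n ≠ 0) (hE : ∀ i k, 0 ≤ E i k) (hE0 : ∀ i, 0 < E i 0) :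
    ∑ S : Finset (Fin n) with Even S.card,
      (∏ i, (if i ∈ S then Real.sin (angle E) * E i 1 else Real.cos (angle E) * E i 0)) ^
        (1 / (n : ℝ)) = evenSum E / normFactor E := by
  have hN := normFactor_pos hE hE0
  have ha := prodPow_nonneg hE 0 (1 / (n : ℝ) ^ 2)
  have hb := prodPow_nonneg hE 1 (1 / (n : ℝ) ^ 2)
  rw [evenSum_eq_sum_finset, Finset.sum_div]
  refine Finset.sum_congr rfl fun S _ => ?_
  have hS : S.card ≤ n := by simpa using Finset.card_le_univ S
  have hite : ∀ i, 0 ≤ if i ∈ S then E i 1 else E i 0 := fun i => by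
    split_ifs
    exacts [hE i 1, hE i 0]
  have hsplit : ∏ i, (if i ∈ S then Real.sin (angle E) * E i 1 else Real.cos (angle E) * E i 0) =
      (prodPow E 0 (1 / (n : ℝ) ^ 2) ^ (n - S.card) * prodPow E 1 (1 / (n : ℝ) ^ 2) ^ S.card) /
        normFactor E ^ n * ∏ i, (if i ∈ S then E i 1 else E i 0) := by
    have h1 : ∀ i, (if i ∈ S then Real.sin (angle E) * E i 1 else Real.cos (angle E) * E i 0) =
        (if i ∈ S then Real.sin (angle E) else Real.cos (angle E)) *
          (if i ∈ S then E i 1 else E i 0) := fun i => by split_ifs <;> rfl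
    simp_rw [h1]
    rw [Finset.prod_mul_distrib, Finset.prod_ite, Finset.prod_const, Finset.prod_const,
      Finset.filter_mem_eq_inter, Finset.univ_inter, Finset.filter_not, Finset.filter_mem_eq_inter,
      Finset.univ_inter, Finset.card_sdiff_of_subset (Finset.subset_univ S), Finset.card_univ,
      Fintype.card_fin, sin_angle hE, cos_angle hE hE0, div_pow, div_pow, div_mul_div_comm,
      ← pow_add, Nat.add_sub_cancel' hS]
    ring
  rw [hsplit, prod_pow_mul_pow_rpow hE, Real.mul_rpow (by positivity)
    (Finset.prod_nonneg fun i _ => hite i), Real.div_rpow (by positivity) (by positivity),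
    ← Real.finsetProd_rpow _ _ fun i _ => hite i, one_div (n : ℝ),
    Real.pow_rpow_inv_natCast hN.le hn]
  ring

theorem cos_angle_nonneg (E : Fin n → Fin 3 → ℝ) : 0 ≤ Real.cos (angle E) :=
  Real.cos_arcsin_nonneg _

theorem sin_angle_nonneg (hE : ∀ i k, 0 ≤ E i k) : 0 ≤ Real.sin (angle E) := by
  rw [sin_angle hE]
  exact div_nonneg (prodPow_nonneg hE _ _) (Real.sqrt_nonneg _)

theorem one_le_cos_add_sin (hE : ∀ i k, 0 ≤ E i k) :
    1 ≤ Real.cos (angle E) + Real.sin (angle E) := by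
  have hc := cos_angle_nonneg E
  have hs := sin_angle_nonneg hE
  have := Real.sin_sq_add_cos_sq (angle E)
  nlinarith [mul_nonneg hc hs]

theorem starV_eq (E : Fin n → Fin 3 → ℝ) :
    starV E = evenSum E / normFactor E / 2 ^ (n - 2) := by
  rw [starV, div_div, mul_comm]

/-- The AM-GM bound used for hidden variables applies here with `cos t E_{i1}` and `sin t E_{i2}`,
whose sum is at most `cos t + sin t`. -/
theorem starV_le_cos_add_sin (hn : 2 ≤ n) (hE : ∀ i k, 0 ≤ E i k) (hE0 : ∀ i, 0 < E i 0)
    (hE0' : ∀ i, E i 0 ≤ 1) (hE1' : ∀ i, E i 1 ≤ 1) :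
    starV E ≤ Real.cos (angle E) + Real.sin (angle E) := by
  have hn0 : (0 : ℝ) < n := by exact_mod_cast (by omega : 0 < n)
  have hc := cos_angle_nonneg E
  have hs := sin_angle_nonneg hE
  rw [starV_eq, ← sum_even_angle (by omega) hE hE0, div_le_iff₀' (by positivity)]
  refine (sum_even_prod_rpow_le hn (fun i => Real.cos (angle E) * E i 0)
    (fun i => Real.sin (angle E) * E i 1) (fun i => mul_nonneg hc (hE i 0))
    (fun i => mul_nonneg hs (hE i 1))).trans ?_
  refine mul_le_mul_of_nonneg_left ?_ (by positivity)
  rw [div_le_iff₀' hn0]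
  calc _ ≤ ∑ i : Fin n, (Real.cos (angle E) + Real.sin (angle E)) :=
        Finset.sum_le_sum fun i _ => add_le_add (mul_le_of_le_one_right hc (hE0' i))
          (mul_le_of_le_one_right hs (hE1' i))
    _ = _ := by simp [mul_add]

theorem starV_pos (hE : ∀ i k, 0 ≤ E i k) (hE0 : ∀ i, 0 < E i 0) (h : 0 < evenSum E) :
    0 < starV E := by
  have := normFactor_pos hE hE0
  rw [starV]
  positivity

/-- With `n = m + 2`, this splits the constant of `(∗)` into the `4ⁿ` of its right side and the
`(2^(n-2))ⁿ` of `Vⁿ`. -/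
theorem two_pow_sq_eq (m : ℕ) : (2 : ℝ) ^ ((m + 2) ^ 2) = 4 ^ (m + 2) * (2 ^ m) ^ (m + 2) := by
  rw [show (4 : ℝ) = 2 ^ 2 by norm_num, ← pow_mul, ← pow_mul, ← pow_add]
  congr 1
  ring

theorem etaBound_lt_one (hn : 2 ≤ n) (hE : ∀ i k, 0 ≤ E i k) (hE0 : ∀ i, 0 < E i 0)
    (h : SourceCondition E) : etaBound E < 1 := by
  have hN := normFactor_pos hE hE0
  have hsum := evenSum_pos_of_sourceCondition (by omega) hE h
  rw [etaBound, div_lt_one (pow_pos (starV_pos hE hE0 hsum) _), cos_angle hE hE0, sin_angle hE,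
    starV, ← add_div, div_pow, div_pow, div_lt_div_iff₀ (by positivity) (by positivity)]
  rw [SourceCondition] at h
  generalize prodPow E 0 (1 / (n : ℝ) ^ 2) + prodPow E 1 (1 / (n : ℝ) ^ 2) = c at h ⊢
  generalize normFactor E = N at h hN ⊢
  generalize evenSum E = σ at h hsum ⊢
  obtain ⟨m, rfl⟩ := Nat.exists_eq_add_of_le' hn
  rw [two_pow_sq_eq, mul_pow 4 σ, mul_assoc, mul_assoc] at h
  have h' := lt_of_mul_lt_mul_left h (by positivity)
  rw [Nat.add_sub_cancel, show m + 2 - 1 = m + 1 by omega, mul_pow] at *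
  calc c ^ (m + 1) * ((2 ^ m) ^ (m + 2) * N ^ (m + 2)) =
        ((2 ^ m) ^ (m + 2) * (N * c ^ (m + 1))) * N ^ (m + 1) := by ring
    _ < _ := mul_lt_mul_of_pos_right h' (by positivity)

theorem sourceCondition_one (hn : 2 ≤ n) :
    SourceCondition (fun (_ : Fin n) (_ : Fin 3) => (1 : ℝ)) := by
  have hp : ∀ k s, prodPow (fun (_ : Fin n) (_ : Fin 3) => (1 : ℝ)) k s = 1 := fun k s => by
    simp [prodPow]
  -- Every term is `1`, so this is the number of even sets, counted with `a = b = 1`.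
  have hsum : evenSum (fun (_ : Fin n) (_ : Fin 3) => (1 : ℝ)) = 2 ^ (n - 2) * (1 + 1) := by
    have := sum_even_ite_mem (ι := Fin n) (by simpa using hn) ⟨0, by omega⟩ 1 1
    rw [Fintype.card_fin] at this
    rw [evenSum_eq_sum_finset, ← this]
    refine Finset.sum_congr rfl fun S _ => ?_
    simp
  rw [SourceCondition, normFactor, hsum, hp, hp, hp, hp]
  obtain ⟨m, rfl⟩ := Nat.exists_eq_add_of_le' hn
  have hsqrt : √((1 : ℝ) + 1) < 2 := by
    rw [Real.sqrt_lt' (by norm_num)]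
    norm_num
  rw [two_pow_sq_eq, Nat.add_sub_cancel, show m + 2 - 1 = m + 1 by omega, mul_pow, mul_pow]
  calc (4 : ℝ) ^ (m + 2) * (2 ^ m) ^ (m + 2) * √(1 + 1) * (1 + 1) ^ (m + 1)
      < 4 ^ (m + 2) * (2 ^ m) ^ (m + 2) * 2 * (1 + 1) ^ (m + 1) := by gcongr
    _ = _ := by norm_num; ring

end SourceCondition

/-! ### The value attained by the noisy strategy -/

section Violation

variable {n : ℕ} [NeZero n] {E : Fin n → Fin 3 → ℝ}

theorem starLHS_quantumCorr (hE : ∀ i k, 0 ≤ E i k) (hE0 : ∀ i, 0 < E i 0)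
    {ρ : Fin n → TwoQubit} (hρ : ∀ i, (ρ i).IsHermitian) (h0 : ∀ i, corrTensor (ρ i) 0 0 = E i 0)
    (h1 : ∀ i, corrTensor (ρ i) 1 1 = E i 1) {η : Fin n → ℝ} (hη : ∀ i, 0 ≤ η i) :
    starLHS (quantumCorr ρ fun i => noisyPair (η i) (angle E)) =
      (∏ i, η i) ^ (1 / (n : ℝ)) * starV E := by
  have hc := cos_angle_nonneg E
  have hs := sin_angle_nonneg hE
  rw [starLHS, starV_eq, ← sum_even_angle (NeZero.ne n) hE hE0, mul_div_assoc', mul_comm,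
    mul_one_div, Finset.mul_sum]
  congr 1
  refine Finset.sum_congr rfl fun S hS => ?_
  have hnn : ∀ i, 0 ≤ if i ∈ S then Real.sin (angle E) * E i 1 else Real.cos (angle E) * E i 0 :=
    fun i => by
      split_ifs
      exacts [mul_nonneg hs (hE i 1), mul_nonneg hc (hE i 0)]
  rw [starJ_quantumCorr hρ η _ (Finset.mem_filter.1 hS).2]
  simp_rw [h0, h1]
  rw [Finset.prod_mul_distrib, abs_of_nonneg (mul_nonneg (Finset.prod_nonneg fun i _ => hη i)
    (Finset.prod_nonneg fun i _ => hnn i)), Real.mul_rpow (Finset.prod_nonneg fun i _ => hη i)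
    (Finset.prod_nonneg fun i _ => hnn i)]

theorem one_lt_rpow_inv_mul {m : ℕ} (hm : m ≠ 0) {x v : ℝ} (hx : 0 ≤ x) (hv : 0 ≤ v)
    (h : 1 < x * v ^ m) : 1 < x ^ (1 / (m : ℝ)) * v := by
  have := Real.one_lt_rpow h (z := 1 / (m : ℝ)) (by positivity)
  rwa [Real.mul_rpow hx (by positivity), one_div, Real.pow_rpow_inv_natCast hv hm, ← one_div] at this

end Violation

end StarNetwork

/-! ### The theorem -/

theorem theorem4 (n : ℕ) [NeZero n] (hn : 2 ≤ n) :
    (∃ ρ : Fin n → StarNetwork.TwoQubit, (∀ i, StarNetwork.IsState (ρ i)) ∧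
      StarNetwork.SourceCondition fun i => StarNetwork.singVal (ρ i)) ∧
    ∀ ρ : Fin n → StarNetwork.TwoQubit, (∀ i, StarNetwork.IsState (ρ i)) →
    ∀ E : Fin n → Fin 3 → ℝ, (E = fun i => StarNetwork.singVal (ρ i)) →
    StarNetwork.SourceCondition E →
      (∃ U W : Fin n → Matrix.unitaryGroup (Fin 2) ℂ,
        ∀ i, StarNetwork.IsCanonical (StarNetwork.localRotate (U i) (W i) (ρ i))) ∧
      StarNetwork.etaBound E < 1 ∧
      ∀ U W : Fin n → Matrix.unitaryGroup (Fin 2) ℂ,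
        (∀ i, StarNetwork.IsCanonical (StarNetwork.localRotate (U i) (W i) (ρ i))) →
        ∀ (s : Fin n) (η₁ : ℝ), StarNetwork.etaBound E < η₁ → η₁ ≤ 1 →
          ¬ StarNetwork.Compatible (StarNetwork.noisyPair η₁ (StarNetwork.angle E)) ∧
          ∃ η : Fin n → ℝ, η s = η₁ ∧
            (∀ i, i ≠ s → 0 ≤ η i ∧ η i ≤ 1 ∧
              StarNetwork.Compatible (StarNetwork.noisyPair (η i) (StarNetwork.angle E))) ∧
            1 < StarNetwork.starLHS (StarNetwork.quantumCorr
              (fun i => StarNetwork.localRotate (U i) (W i) (ρ i))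
              (fun i => StarNetwork.noisyPair (η i) (StarNetwork.angle E))) ∧
            ¬ StarNetwork.IsNLocal.{u} (StarNetwork.quantumCorr
              (fun i => StarNetwork.localRotate (U i) (W i) (ρ i))
              (fun i => StarNetwork.noisyPair (η i) (StarNetwork.angle E))) := by
  refine ⟨⟨fun _ => StarNetwork.bellState, fun _ => StarNetwork.isState_bellState, ?_⟩, ?_⟩
  · have h1 : (fun _ : Fin n => StarNetwork.singVal StarNetwork.bellState) = fun _ _ => 1 := by
      funext i k
      exact StarNetwork.singVal_bellState k
    rw [h1]
    exact StarNetwork.sourceCondition_one hn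
  intro ρ hρ E hEdef hcond
  have hE : ∀ i k, 0 ≤ E i k := fun i k => by
    rw [hEdef]
    exact StarNetwork.singVal_nonneg _ _
  have hE10 : ∀ i, E i 1 ≤ E i 0 := fun i => by
    rw [hEdef]
    exact LinearMap.singularValues_antitone _ (by norm_num)
  have hsum := StarNetwork.evenSum_pos_of_sourceCondition (NeZero.ne n) hE hcond
  have hE0 := StarNetwork.pos_of_evenSum_pos hE hE10 hsum
  have hV := StarNetwork.starV_pos hE hE0 hsum
  refine ⟨?_, StarNetwork.etaBound_lt_one hn hE hE0 hcond, ?_⟩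
  · choose U W h using fun i => StarNetwork.exists_isCanonical_localRotate (ρ i)
    exact ⟨U, W, h⟩
  intro U W hcan s η₁ hη hη1
  have hstate := fun i => StarNetwork.isState_localRotate (hρ i) (U i) (W i)
  have h00 : ∀ i, StarNetwork.corrTensor (StarNetwork.localRotate (U i) (W i) (ρ i)) 0 0 = E i 0 :=
    fun i => by
      rw [StarNetwork.corrTensor_zero_zero_of_isCanonical (hcan i),
        StarNetwork.singVal_localRotate, hEdef]
  have h11 : ∀ i, StarNetwork.corrTensor (StarNetwork.localRotate (U i) (W i) (ρ i)) 1 1 = E i 1 :=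
    fun i => by
      rw [StarNetwork.corrTensor_one_one_of_isCanonical (hcan i),
        StarNetwork.singVal_localRotate, hEdef]
  -- The two largest singular values are tensor entries of the rotated state, hence at most `1`.
  have hVle := StarNetwork.starV_le_cos_add_sin hn hE hE0
    (fun i => h00 i ▸ StarNetwork.corrTensor_le_one (hstate i) 0 0)
    (fun i => h11 i ▸ StarNetwork.corrTensor_le_one (hstate i) 1 1)
  have hr1 := StarNetwork.one_le_cos_add_sin hE
  have hc := StarNetwork.cos_angle_nonneg E
  have hs := StarNetwork.sin_angle_nonneg hE
  rw [StarNetwork.etaBound, div_lt_iff₀ (pow_pos hV n)] at hη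
  set t := StarNetwork.angle E with ht
  set r := Real.cos t + Real.sin t with hr
  have hr0 : 0 < r := by linarith
  have hη0 : 0 < η₁ := by
    have h : 0 < η₁ * StarNetwork.starV E ^ n := (pow_pos hr0 (n - 1)).trans hη
    exact pos_of_mul_pos_left h (pow_pos hV n).le
  refine ⟨fun hcomp => ?_, ?_⟩
  -- Compatibility would give `η₁ Vⁿ ≤ η₁ rⁿ ≤ r^(n-1)`, against the lower bound on `η₁`.
  · have h1 := StarNetwork.mul_cos_add_sin_le_one_of_compatible hcomp
    have h2 : η₁ * StarNetwork.starV E ^ n ≤ η₁ * r ^ n :=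
      mul_le_mul_of_nonneg_left (pow_le_pow_left₀ hV.le hVle n) hη0.le
    have h3 : η₁ * r ^ n = (η₁ * r) * r ^ (n - 1) := by
      rw [mul_assoc, mul_pow_sub_one (NeZero.ne n)]
    have h4 : (η₁ * r) * r ^ (n - 1) ≤ r ^ (n - 1) :=
      mul_le_of_le_one_left (pow_pos hr0 _).le h1
    linarith
  -- `r⁻¹` is the largest noise parameter at which a pair is still compatible.
  have hηi0 : ∀ i, 0 ≤ Function.update (fun _ : Fin n => r⁻¹) s η₁ i := fun i => by
    rw [Function.update_apply]
    split_ifs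
    exacts [hη0.le, inv_nonneg.2 hr0.le]
  have hprod : ∏ i, Function.update (fun _ : Fin n => r⁻¹) s η₁ i = η₁ * r⁻¹ ^ (n - 1) := by
    rw [Finset.prod_update_of_mem (Finset.mem_univ s), Finset.prod_const,
      Finset.card_sdiff_of_subset (Finset.subset_univ _), Finset.card_univ, Fintype.card_fin,
      Finset.card_singleton]
  have hviol : 1 < StarNetwork.starLHS (StarNetwork.quantumCorr
      (fun i => StarNetwork.localRotate (U i) (W i) (ρ i))
      (fun i => StarNetwork.noisyPair (Function.update (fun _ : Fin n => r⁻¹) s η₁ i) t)) := by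
    rw [StarNetwork.starLHS_quantumCorr hE hE0 (fun i => (hstate i).1.isHermitian) h00 h11 hηi0,
      hprod]
    refine StarNetwork.one_lt_rpow_inv_mul (NeZero.ne n) (by positivity) hV.le ?_
    rw [inv_pow, mul_right_comm, ← div_eq_mul_inv, one_lt_div (pow_pos hr0 _)]
    exact hη
  refine ⟨Function.update (fun _ => r⁻¹) s η₁, Function.update_self _ _ _, fun i hi => ?_, hviol,
    fun hloc => absurd (StarNetwork.starLHS_le_one hn hloc) (not_le.2 hviol)⟩
  rw [Function.update_of_ne hi]
  exact ⟨inv_nonneg.2 hr0.le, inv_le_one_of_one_le₀ hr1, StarNetwork.compatible_noisyPair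
    (mul_nonneg (inv_nonneg.2 hr0.le) hc) (mul_nonneg (inv_nonneg.2 hr0.le) hs)
    (inv_mul_cancel₀ hr0.ne')⟩
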